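/- Let $0<\alpha\le 1$ and $0<d<D$. Let $H^1=H^1([0,1])$ be the space of $f\in L^2([0,1])$ with a weak derivative $f'\in L^2([0,1])$, with norm $\|f\|_{H^1}=\|f\|_{L^2}+\|f'\|_{L^2}$ (we use continuous representatives). For $0<\beta\le 1$ let $\|f\|_{C^\beta}=\sup_{[0,1]}|f|+\sup_{x\ne y}|f(x)-f(y)|/|x-y|^\beta$, and $\|f\|_{C^{1,\beta}}=\sup_{[0,1]}|f|+\|f'\|_{C^\beta}$. Let $$\Theta_\alpha=\Big\{(\sigma,\mu)\in H^1\times C^\alpha([0,1]):\ \|\sigma\|_{H^1}\le D,\ \|\mu\|_{C^\alpha}\le D,\ \inf_{x\in[0,1]}\min(\sigma(x),\mu(x))\ge d,\ \int_0^1\mu(x)\,dx=1\Big\}.$$ For $(\sigma,\mu)\in\Theta_\alpha$ consider the eigenvalue problem: find $\lambda\in\mathbb R$ and $0\ne w\in H^1$ such that $$\int_0^1 w'v'\sigma^2\mu\,dx=2\lambda\int_0^1 wv\mu\,dx\qquad\text{for all }v\in H^1.$$ Let $\lambda_0\le\lambda_1\le\lambda_2\le\dots$ be its eigenvalues, repeated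 according to multiplicity (so $\lambda_0=0$); that is, $\lambda_k$ is the least $t$ for which there are $k+1$ linearly independent eigenfunctions with eigenvalues at most $t$. Let $\|w\|_{L^2(\mu)}=(\int_0^1 w^2\mu\,dx)^{1/2}$. (i) There are constants $0<c\le C<\infty$, depending only on $\alpha,d,D$, such that for every $(\sigma,\mu)\in\Theta_\alpha$ the eigenvalues $\lambda_1,\lambda_2$ exist and satisfy $c\le\lambda_1$, $\lambda_1\le C$, $\lambda_2\le C$, $\lambda_2-\lambda_1\ge c$, and every eigenfunction $w_1$ for $\lambda_1$ is differentiable on $[0,1]$ with $$\frac{\|w_1\|_{C^{1,\min(1/2,\alpha)}}}{\|w_1\|_{L^2(\mu)}}\le C.$$ (ii) For all $0<a<b<1$ there is a constant $c'>0$, depending only on $\alpha,d,D,a,b$, such that for every $(\sigma,\mu)\in\Theta_\alpha$ and every eigenfunction $w_1$ for $\lambda_1$, $$\inf_{x\in[a,b]}|w_1'(x)|\ \ge\ c'\,\|w_1\|_{L^2(\mu)}.$$ -/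

import Mathlib

open MeasureTheory Set
open scoped NNReal ENNReal ContDiff

noncomputable section

namespace HoelderEigen

/-- Lebesgue measure on the unit interval `[0,1]`. -/
def vol01 : Measure ℝ := volume.restrict (Icc 0 1)

/-- `g` is a weak derivative of `f` on `(0,1)`: the integration-by-parts identity holds against all
smooth test functions with compact support in `(0,1)`. -/
def HasWeakDeriv (f g : ℝ → ℝ) : Prop :=
  ∀ φ : ℝ → ℝ, ContDiff ℝ ∞ φ → HasCompactSupport φ → tsupport φ ⊆ Ioo 0 1 →
    ∫ x, f x * deriv φ x ∂vol01 = -∫ x, g x * φ x ∂vol01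

/-- `f ∈ H¹([0,1])`: `f` is in `L²([0,1])` and has a weak derivative in `L²([0,1])`.
Only the values of `f` on `[0,1]`, up to null sets, matter. -/
def MemH1 (f : ℝ → ℝ) : Prop :=
  MemLp f 2 vol01 ∧ ∃ g : ℝ → ℝ, MemLp g 2 vol01 ∧ HasWeakDeriv f g

open Classical in
/-- The square integrable weak derivative of `f ∈ H¹([0,1])`, which is unique up to null sets of
`[0,1]` (and `0` by convention if there is none). -/
def weakDeriv (f : ℝ → ℝ) : ℝ → ℝ :=
  if h : ∃ g : ℝ → ℝ, MemLp g 2 vol01 ∧ HasWeakDeriv f g then h.choose else 0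

/-- The norm `‖f‖_{L²} + ‖f'‖_{L²}` of `f ∈ H¹([0,1])`. -/
def h1Norm (f : ℝ → ℝ) : ℝ≥0∞ :=
  eLpNorm f 2 vol01 + eLpNorm (weakDeriv f) 2 vol01

/-- The supremum norm over `[0,1]`. -/
def supNorm (f : ℝ → ℝ) : ℝ≥0∞ := ⨆ x ∈ Icc (0 : ℝ) 1, ‖f x‖ₑ

/-- The Hölder seminorm `sup_{x ≠ y} |f x - f y| / |x - y|^β` over `[0,1]`. -/
def holderSeminorm (β : ℝ≥0) (f : ℝ → ℝ) : ℝ≥0∞ :=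
  eHolderNorm β ((Icc (0 : ℝ) 1).domRestrict f)

/-- The norm of `C^β([0,1])`; it is finite exactly on `C^β([0,1])`. -/
def holderNorm (β : ℝ≥0) (f : ℝ → ℝ) : ℝ≥0∞ := supNorm f + holderSeminorm β f

/-- The classical derivative on `[0,1]`, one-sided at the end points. -/
def deriv01 (f : ℝ → ℝ) : ℝ → ℝ := derivWithin f (Icc 0 1)

/-- The norm `‖f‖_∞ + ‖f'‖_∞ + [f']_β` of `C^{1,β}([0,1])`, for `f` differentiable on `[0,1]`. -/
def c1HolderNorm (β : ℝ≥0) (f : ℝ → ℝ) : ℝ≥0∞ := supNorm f + holderNorm β (deriv01 f)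

/-- The norm of `L²(μ)`, where `μ` is a density on `[0,1]`. -/
def l2Norm (μ f : ℝ → ℝ) : ℝ := Real.sqrt (∫ x, f x ^ 2 * μ x ∂vol01)

/-- The class of coefficients `(σ, μ) ∈ H¹([0,1]) × C^α([0,1])` with
`‖σ‖_{H¹}, ‖μ‖_{C^α} ≤ D`, `inf (σ ∧ μ) ≥ d` and `∫ μ = 1`.
The function `σ` is the continuous representative of its class in `H¹([0,1])`. -/
structure MemTheta (α : ℝ≥0) (d D : ℝ) (σ μ : ℝ → ℝ) : Prop where
  memH1 : MemH1 σ
  continuousOn : ContinuousOn σ (Icc 0 1)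
  h1Norm_le : h1Norm σ ≤ ENNReal.ofReal D
  holderNorm_le : holderNorm α μ ≤ ENNReal.ofReal D
  le_inf : ∀ x ∈ Icc (0 : ℝ) 1, d ≤ min (σ x) (μ x)
  integral_eq_one : ∫ x, μ x ∂vol01 = 1

/-- `(lam, w)` is a solution of the eigenproblem: `w ∈ H¹([0,1])`, `w ≠ 0`, and
`∫ w' v' σ² μ = 2 lam ∫ w v μ` for all `v ∈ H¹([0,1])`.
The function `w` is the continuous representative of its class in `H¹([0,1])`. -/
structure IsEigenpair (σ μ : ℝ → ℝ) (lam : ℝ) (w : ℝ → ℝ) : Prop where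
  memH1 : MemH1 w
  continuousOn : ContinuousOn w (Icc 0 1)
  ne_zero : ∃ x ∈ Icc (0 : ℝ) 1, w x ≠ 0
  weak_eq : ∀ v : ℝ → ℝ, MemH1 v →
    ∫ x, weakDeriv w x * weakDeriv v x * σ x ^ 2 * μ x ∂vol01 =
      2 * lam * ∫ x, w x * v x * μ x ∂vol01

/-- `t` is the eigenvalue `λ_k` in the enumeration `λ_0 ≤ λ_1 ≤ λ_2 ≤ …` of the eigenvalues repeated
according to multiplicity: the least `t` such that there are `k + 1` eigenfunctions, linearly
independent on `[0,1]`, with eigenvalues at most `t`. -/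
def IsNthEigenvalue (σ μ : ℝ → ℝ) (k : ℕ) (t : ℝ) : Prop :=
  IsLeast {t : ℝ | ∃ (s : Fin (k + 1) → ℝ) (u : Fin (k + 1) → ℝ → ℝ),
    (∀ i, s i ≤ t ∧ IsEigenpair σ μ (s i) (u i)) ∧
    LinearIndependent ℝ (fun i => (Icc (0 : ℝ) 1).domRestrict (u i))} t

end HoelderEigen

end

noncomputable section

namespace HoelderEigen

/-! Write `p = σ² μ` and `m = μ`. With the flux `q = p w'`, the weak eigenvalue equation is the
first order system `w' = q / p`, `q' = -2 λ m w` with natural boundary conditions `q(0) = q(1) = 0`.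
Its coefficients are continuous, so `w` is `C¹`.

In polar coordinates with a scale `s > 0`, `w = w(0) ρ cos θ` and `q = -w(0) s ρ sin θ`, the system
decouples: `θ' = (s/p) sin² θ + (2λm/s) cos² θ` with `θ(0) = 0`, and `(log ρ)' = (2λm/s - s/p) sin θ
cos θ`. The remaining condition is `sin θ(1) = 0`. For `λ ≥ 0` the number `θ(1)` is continuous and
strictly increasing in `λ`, and it vanishes at `λ = 0`. Hence all eigenvalues are simple and `λ_n`
is the parameter with `θ(1) = nπ` (`isNthEigenvalue`).

Every bound is then explicit, without compactness. A suitable `s` and `Λ` force `θ(1) ≥ 2π` at `λ =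
Λ`, so `λ₁, λ₂ ≤ Λ` (`pi_le_angle`). A Lipschitz bound of `θ(1)` in `λ` (`angle_sub_le`) makes an
increase by `π` cost a fixed amount of `λ`; this bounds both `λ₁ = λ₁ - λ₀` and `λ₂ - λ₁` from
below. Since `|log ρ| ≤ κ`, both `w` and `q` are bounded by multiples of `|w(0)|`, which is
comparable to the `L²(μ)` norm. The Hölder bound on `w' = q / p` follows because `q` is Lipschitz
and `p` has Hölder exponent `min(1/2, α)`.

For `λ₁` the angle runs from `0` to `π` with speed bounded below. On `[a, b]` it therefore keeps
away from both ends, so `|sin θ|`, and with it `|w'|`, is bounded below there (`le_abs_deriv`). -/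

instance : IsFiniteMeasure vol01 := by unfold vol01; infer_instance

/-! ### Integrals and primitives on the unit interval -/

theorem integral_vol01 (f : ℝ → ℝ) : ∫ x, f x ∂vol01 = ∫ x in (0 : ℝ)..1, f x := by
  rw [intervalIntegral.integral_of_le zero_le_one, vol01, integral_Icc_eq_integral_Ioc]

theorem integrable_vol01_iff {f : ℝ → ℝ} :
    Integrable f vol01 ↔ IntervalIntegrable f volume 0 1 := by
  rw [intervalIntegrable_iff_integrableOn_Icc_of_le zero_le_one]; rfl

theorem ae_vol01_mem : ∀ᵐ x ∂vol01, x ∈ Icc (0 : ℝ) 1 := ae_restrict_mem measurableSet_Icc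

theorem ae_vol01_mem_Ioo : ∀ᵐ x ∂vol01, x ∈ Ioo (0 : ℝ) 1 := by
  rw [vol01, ← restrict_Ioo_eq_restrict_Icc]; exact ae_restrict_mem measurableSet_Ioo

theorem integrable_vol01_of_continuousOn {f : ℝ → ℝ} (hf : ContinuousOn f (Icc 0 1)) :
    Integrable f vol01 := hf.integrableOn_compact isCompact_Icc

theorem memLp_vol01_of_continuousOn {f : ℝ → ℝ} (hf : ContinuousOn f (Icc 0 1)) :
    MemLp f 2 vol01 := by
  obtain ⟨C, hC⟩ := isCompact_Icc.exists_bound_of_continuousOn hf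
  exact MemLp.of_bound (hf.aestronglyMeasurable measurableSet_Icc) C
    (ae_vol01_mem.mono fun x hx => hC x hx)

theorem eqOn_of_ae_eq {f g : ℝ → ℝ} (hf : ContinuousOn f (Icc 0 1)) (hg : ContinuousOn g (Icc 0 1))
    (h : f =ᵐ[vol01] g) : EqOn f g (Icc 0 1) :=
  Measure.eqOn_Icc_of_ae_eq volume (by norm_num) h hf hg

/-- The primitive of `g` with value `c` at `0`. -/
def primitive (c : ℝ) (g : ℝ → ℝ) (x : ℝ) : ℝ := c + ∫ t in (0 : ℝ)..x, g t

@[simp] theorem primitive_zero (c : ℝ) (g : ℝ → ℝ) : primitive c g 0 = c := by simp [primitive]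

theorem primitive_congr {c : ℝ} {f g : ℝ → ℝ} (h : f =ᵐ[vol01] g) :
    EqOn (primitive c f) (primitive c g) (Icc 0 1) := by
  intro x hx
  simp only [primitive]
  congr 1
  refine intervalIntegral.integral_congr_ae ?_
  rw [Filter.EventuallyEq, vol01, ae_restrict_iff' measurableSet_Icc] at h
  filter_upwards [h] with t ht h1
  rw [uIoc_of_le hx.1] at h1
  exact ht ⟨h1.1.le, h1.2.trans hx.2⟩

theorem hasDerivAt_primitive {g : ℝ → ℝ} (hg : Continuous g) (c x : ℝ) :
    HasDerivAt (primitive c g) (g x) x :=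
  (intervalIntegral.integral_hasDerivAt_right (hg.intervalIntegrable _ _)
    (hg.stronglyMeasurableAtFilter _ _) hg.continuousAt).const_add c

theorem continuousOn_primitive {g : ℝ → ℝ} (hg : Integrable g vol01) (c : ℝ) :
    ContinuousOn (primitive c g) (Icc 0 1) := by
  have := intervalIntegral.continuousOn_primitive_interval (f := g) (μ := volume) (a := 0) (b := 1)
    (by rw [uIcc_of_le zero_le_one]; exact hg)
  rw [uIcc_of_le zero_le_one] at this
  exact continuousOn_const.add this

theorem primitive_sub {g : ℝ → ℝ} (hg : Integrable g vol01) (c : ℝ) {x y : ℝ}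
    (hx : x ∈ Icc (0 : ℝ) 1) (hy : y ∈ Icc (0 : ℝ) 1) :
    primitive c g y - primitive c g x = ∫ t in x..y, g t := by
  have h := integrable_vol01_iff.1 hg
  have hm : ∀ {z : ℝ}, z ∈ Icc (0 : ℝ) 1 → IntervalIntegrable g volume 0 z := fun hz =>
    h.mono_set (by rw [uIcc_of_le hz.1, uIcc_of_le zero_le_one]; exact Icc_subset_Icc_right hz.2)
  simp only [primitive, add_sub_add_left_eq_sub]
  exact intervalIntegral.integral_interval_sub_left (hm hy) (hm hx)

theorem primitive_eq_of_hasDerivAt {f g : ℝ → ℝ} (hg : ContinuousOn g (Icc 0 1))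
    (h : ∀ x ∈ Icc (0 : ℝ) 1, HasDerivAt f (g x) x) : EqOn f (primitive (f 0) g) (Icc 0 1) := by
  intro x hx
  have : uIcc 0 x ⊆ Icc (0 : ℝ) 1 := by
    rw [uIcc_of_le hx.1]; exact Icc_subset_Icc_right hx.2
  rw [primitive, intervalIntegral.integral_eq_sub_of_hasDerivAt (fun t ht => h t (this ht))
    (hg.mono this).intervalIntegrable]
  ring

/-- Primitives of integrable functions are absolutely continuous with the expected derivative almost
everywhere, so the absolutely continuous integration by parts applies. -/
theorem primitive_integral_by_parts {f g : ℝ → ℝ} (hf : Integrable f vol01)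
    (hg : Integrable g vol01) (c k : ℝ) :
    ∫ x, primitive c f x * g x ∂vol01 =
      primitive c f 1 * primitive k g 1 - c * k - ∫ x, f x * primitive k g x ∂vol01 := by
  have hf' := integrable_vol01_iff.1 hf
  have hg' := integrable_vol01_iff.1 hg
  have ac : ∀ {h : ℝ → ℝ} (a : ℝ), IntervalIntegrable h volume 0 1 →
      AbsolutelyContinuousOnInterval (primitive a h) 0 1 := fun a hh => by
    have h1 := hh.absolutelyContinuousOnInterval_intervalIntegral (c := 0) (by simp)
    have h2 : AbsolutelyContinuousOnInterval (fun _ : ℝ => a) 0 1 :=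
      (LipschitzWith.const a).lipschitzOnWith.absolutelyContinuousOnInterval
    exact h2.fun_add h1
  have hd : ∀ {h : ℝ → ℝ} (a : ℝ), IntervalIntegrable h volume 0 1 →
      ∀ᵐ x, x ∈ uIoc (0 : ℝ) 1 → deriv (primitive a h) x = h x := fun a hh => by
    filter_upwards [hh.ae_hasDerivAt_integral] with x hx h1
    exact ((hx (uIoc_subset_uIcc h1) 0 (by simp)).const_add a).deriv
  have key := (ac c hf').integral_mul_deriv_eq_deriv_mul (ac k hg')
  rw [primitive_zero, primitive_zero] at key
  rw [integral_vol01, integral_vol01,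
    ← intervalIntegral.integral_congr_ae (f := fun x => primitive c f x * deriv (primitive k g) x),
    key]
  · congr 1
    refine intervalIntegral.integral_congr_ae ?_
    filter_upwards [hd c hf'] with x hx h1
    rw [hx h1]
  · filter_upwards [hd k hg'] with x hx h1
    rw [hx h1]

/-! ### Weak derivatives and `H¹` functions as primitives -/

theorem HasWeakDeriv.congr {f f' g g' : ℝ → ℝ} (h : HasWeakDeriv f g) (hf : f =ᵐ[vol01] f')
    (hg : g =ᵐ[vol01] g') : HasWeakDeriv f' g' := by
  intro φ h1 h2 h3
  have e1 : ∫ x, f x * deriv φ x ∂vol01 = ∫ x, f' x * deriv φ x ∂vol01 :=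
    integral_congr_ae (hf.mul (ae_eq_refl (deriv φ)))
  have e2 : ∫ x, g x * φ x ∂vol01 = ∫ x, g' x * φ x ∂vol01 :=
    integral_congr_ae (hg.mul (ae_eq_refl φ))
  rw [← e1, ← e2]
  exact h φ h1 h2 h3

theorem test_eq_primitive {φ : ℝ → ℝ} (h1 : ContDiff ℝ ∞ φ) :
    EqOn φ (primitive (φ 0) (deriv φ)) (Icc 0 1) :=
  primitive_eq_of_hasDerivAt (h1.continuous_deriv (by simp)).continuousOn fun x _ =>
    (h1.differentiable (by simp) x).hasDerivAt

theorem hasWeakDeriv_primitive {g : ℝ → ℝ} (hg : Integrable g vol01) (c : ℝ) :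
    HasWeakDeriv (primitive c g) g := by
  intro φ h1 h2 h3
  have e := test_eq_primitive h1
  have z : ∀ x, x ∉ Ioo (0 : ℝ) 1 → φ x = 0 := fun x hx =>
    image_eq_zero_of_notMem_tsupport fun h => hx (h3 h)
  rw [primitive_integral_by_parts hg
    (integrable_vol01_of_continuousOn (h1.continuous_deriv (by simp)).continuousOn) c (φ 0),
    ← e (by simp), z 0 (by simp), z 1 (by simp)]
  simp only [mul_zero, sub_zero, zero_sub, neg_inj]
  refine integral_congr_ae (ae_vol01_mem.mono fun x hx => ?_)
  simp only [e hx, z 0 (by simp)]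

theorem ae_eq_zero_of_integral_test {f : ℝ → ℝ} (hf : Integrable f vol01)
    (h : ∀ φ : ℝ → ℝ, ContDiff ℝ ∞ φ → HasCompactSupport φ → tsupport φ ⊆ Ioo 0 1 →
      ∫ x, φ x * f x ∂vol01 = 0) : f =ᵐ[vol01] 0 := by
  have := isOpen_Ioo.ae_eq_zero_of_integral_contDiff_smul_eq_zero
    (hf.locallyIntegrable.locallyIntegrableOn (Ioo (0 : ℝ) 1)) h
  filter_upwards [this, ae_vol01_mem_Ioo] with x h1 h2 using h1 h2

theorem integrable_mul_continuous {f g : ℝ → ℝ} (hf : Integrable f vol01)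
    (hg : ContinuousOn g (Icc 0 1)) : Integrable (fun x => f x * g x) vol01 :=
  integrable_vol01_iff.2 ((integrable_vol01_iff.1 hf).mul_continuousOn
    (by rwa [uIcc_of_le zero_le_one]))

/-- The du Bois-Reymond lemma. -/
theorem HasWeakDeriv.ae_eq_const {f : ℝ → ℝ} (hf : Integrable f vol01) (h : HasWeakDeriv f 0) :
    ∃ c : ℝ, f =ᵐ[vol01] fun _ => c := by
  let B : ContDiffBump (1 / 2 : ℝ) := ⟨1 / 8, 1 / 4, by norm_num, by norm_num⟩
  set ψ₀ : ℝ → ℝ := B.normed volume with hψ₀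
  have c0 : ContDiff ℝ ∞ ψ₀ := B.contDiff_normed
  have t0 : tsupport ψ₀ = Icc (1 / 4) (3 / 4) := by
    rw [hψ₀, B.tsupport_normed_eq, Real.closedBall_eq_Icc]; norm_num [B]
  have i0 : ∫ x in (0 : ℝ)..1, ψ₀ x = 1 := by
    rw [intervalIntegral.integral_eq_integral_of_support_subset]
    · exact B.integral_normed
    · refine (subset_tsupport _).trans (t0 ▸ fun x hx => ⟨?_, ?_⟩) <;> linarith [hx.1, hx.2]
  refine ⟨∫ x, f x * ψ₀ x ∂vol01, ?_⟩
  set k := ∫ x, f x * ψ₀ x ∂vol01 with hk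
  suffices hs : (fun x => f x - k) =ᵐ[vol01] 0 by
    filter_upwards [hs] with x hx
    exact sub_eq_zero.1 hx
  refine ae_eq_zero_of_integral_test (hf.sub (integrable_const _)) fun ψ c1 s1 t1 => ?_
  -- One compact interval inside `(0,1)` carries both `ψ` and `ψ₀`; the test function built below is
  -- supported in it.
  obtain ⟨a, b, ha, hb, hab⟩ : ∃ a b : ℝ, 0 < a ∧ b < 1 ∧
      ∀ x, x ∉ Icc a b → ψ x = 0 ∧ ψ₀ x = 0 := by
    have hK : IsCompact (tsupport ψ ∪ Icc (1 / 4 : ℝ) (3 / 4)) := s1.isCompact.union isCompact_Icc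
    have hne : (tsupport ψ ∪ Icc (1 / 4 : ℝ) (3 / 4)).Nonempty := ⟨1 / 2, Or.inr (by norm_num)⟩
    have hsub : tsupport ψ ∪ Icc (1 / 4 : ℝ) (3 / 4) ⊆ Ioo 0 1 :=
      union_subset t1 fun x hx => ⟨by linarith [hx.1], by linarith [hx.2]⟩
    refine ⟨_, _, (hsub (hK.sInf_mem hne)).1, (hsub (hK.sSup_mem hne)).2, fun x hx => ?_⟩
    have hx' : x ∉ tsupport ψ ∪ Icc (1 / 4 : ℝ) (3 / 4) := fun hm =>
      hx ⟨csInf_le hK.bddBelow hm, le_csSup hK.bddAbove hm⟩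
    exact ⟨image_eq_zero_of_notMem_tsupport fun hm => hx' (Or.inl hm),
      image_eq_zero_of_notMem_tsupport fun hm => hx' (Or.inr (t0 ▸ hm))⟩
  set m := ∫ x in (0 : ℝ)..1, ψ x with hm
  -- Removing the mean of `ψ` makes the primitive of `η` vanish near both end points, so it is an
  -- admissible test function. Testing `f` against it gives `∫ f ψ = k ∫ ψ`.
  set η : ℝ → ℝ := fun x => ψ x - m * ψ₀ x with hη
  have cη : ContDiff ℝ ∞ η := c1.sub (contDiff_const.mul c0)
  have ηz : ∀ x, x ∉ Icc a b → η x = 0 := fun x hx => by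
    simp [hη, (hab x hx).1, (hab x hx).2]
  have η1 : ∫ x in (0 : ℝ)..1, η x = 0 := by
    simp only [hη]
    rw [intervalIntegral.integral_sub (c1.continuous.intervalIntegrable _ _)
      ((c0.continuous.intervalIntegrable _ _).const_mul m), intervalIntegral.integral_const_mul, i0, ← hm]
    ring
  set φ := primitive 0 η with hφ
  have dφ : ∀ x, HasDerivAt φ (η x) x := hasDerivAt_primitive cη.continuous 0
  have dφ' : deriv φ = η := funext fun x => (dφ x).deriv
  have cφ : ContDiff ℝ ∞ φ :=
    contDiff_infty_iff_deriv.2 ⟨fun x => (dφ x).differentiableAt, dφ' ▸ cη⟩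
  have φz : ∀ x, x ∉ Icc a b → φ x = 0 := by
    intro x hx
    simp only [hφ, primitive, zero_add]
    by_cases hxa : x < a
    · rw [intervalIntegral.integral_congr (g := fun _ => 0), intervalIntegral.integral_zero]
      intro t ht
      refine ηz t fun h' => ?_
      have := ht.2
      rw [le_sup_iff] at this
      rcases this with h | h <;> linarith [h'.1]
    · have hbx : b < x := by
        by_contra! h'
        exact hx ⟨not_lt.1 hxa, h'⟩
      rw [← intervalIntegral.integral_add_adjacent_intervals (b := 1)
        (cη.continuous.intervalIntegrable _ _) (cη.continuous.intervalIntegrable _ _), η1, zero_add,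
        intervalIntegral.integral_congr (g := fun _ => 0), intervalIntegral.integral_zero]
      intro t ht
      refine ηz t fun h' => ?_
      have := ht.1
      rw [inf_le_iff] at this
      rcases this with h | h <;> linarith [h'.2]
  have tφ : tsupport φ ⊆ Icc a b :=
    closure_minimal (fun x hx => by_contra fun h' => hx (φz x h')) isClosed_Icc
  have key := h φ cφ (isCompact_Icc.of_isClosed_subset (isClosed_tsupport _) tφ)
    (tφ.trans fun x hx => ⟨ha.trans_le hx.1, hx.2.trans_lt hb⟩)
  rw [dφ'] at key
  have I1 : Integrable (fun x => f x * ψ x) vol01 :=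
    integrable_mul_continuous hf c1.continuous.continuousOn
  have I2 : Integrable (fun x => f x * ψ₀ x) vol01 :=
    integrable_mul_continuous hf c0.continuous.continuousOn
  have I3 : Integrable ψ vol01 := integrable_vol01_of_continuousOn c1.continuous.continuousOn
  have e1 : ∫ x, f x * η x ∂vol01 = ∫ x, f x * ψ x ∂vol01 - m * k := by
    rw [hk, ← integral_const_mul, ← integral_sub I1 (I2.const_mul m)]
    congr 1; ext x; simp only [hη]; ring
  have e2 : ∫ x, ψ x * (f x - k) ∂vol01 = ∫ x, f x * ψ x ∂vol01 - k * m := by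
    rw [hm, ← integral_vol01, ← integral_const_mul, ← integral_sub I1 (I3.const_mul k)]
    congr 1; ext x; ring
  simp only [Pi.zero_apply, zero_mul, integral_zero, neg_zero] at key
  rw [e2]; linarith

/-- Subtracting a primitive of `g` leaves a function with weak derivative zero, which is constant by
du Bois-Reymond. -/
theorem HasWeakDeriv.ae_eq_primitive {f g : ℝ → ℝ} (hf : Integrable f vol01)
    (hg : Integrable g vol01) (h : HasWeakDeriv f g) :
    ∃ c : ℝ, f =ᵐ[vol01] primitive c g := by
  have hp : Integrable (primitive 0 g) vol01 :=
    integrable_vol01_of_continuousOn (continuousOn_primitive hg 0)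
  obtain ⟨c, hc⟩ := HasWeakDeriv.ae_eq_const (hf.sub hp) (fun φ h1 h2 h3 => by
    have cd := (h1.continuous_deriv (by simp)).continuousOn (s := Icc (0 : ℝ) 1)
    have e1 := h φ h1 h2 h3
    have e2 := hasWeakDeriv_primitive hg 0 φ h1 h2 h3
    simp only [Pi.sub_apply, sub_mul, Pi.zero_apply, zero_mul, integral_zero, neg_zero]
    rw [integral_sub (integrable_mul_continuous hf cd) (integrable_mul_continuous hp cd), e1, e2,
      sub_self])
  refine ⟨c, ?_⟩
  filter_upwards [hc] with x hx
  simp only [Pi.sub_apply, primitive] at hx ⊢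
  linarith

theorem HasWeakDeriv.unique {f g g' : ℝ → ℝ} (hg : Integrable g vol01) (hg' : Integrable g' vol01)
    (h : HasWeakDeriv f g) (h' : HasWeakDeriv f g') : g =ᵐ[vol01] g' := by
  suffices hs : (fun x => g x - g' x) =ᵐ[vol01] 0 by
    filter_upwards [hs] with x hx
    exact sub_eq_zero.1 hx
  refine ae_eq_zero_of_integral_test (hg.sub hg') fun φ h1 h2 h3 => ?_
  have c := h1.continuous.continuousOn (s := Icc (0 : ℝ) 1)
  have := (h φ h1 h2 h3).symm.trans (h' φ h1 h2 h3)
  simp only [mul_comm (φ _), sub_mul]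
  rw [integral_sub (integrable_mul_continuous hg c) (integrable_mul_continuous hg' c)]
  linarith

theorem integrable_of_memLp {f : ℝ → ℝ} (hf : MemLp f 2 vol01) : Integrable f vol01 :=
  hf.integrable (by norm_num)

theorem MemH1.weakDeriv_spec {f : ℝ → ℝ} (h : MemH1 f) :
    MemLp (weakDeriv f) 2 vol01 ∧ HasWeakDeriv f (weakDeriv f) := by
  rw [weakDeriv, dif_pos h.2]; exact h.2.choose_spec

theorem MemH1.ae_eq_primitive {f : ℝ → ℝ} (h : MemH1 f) :
    ∃ c : ℝ, f =ᵐ[vol01] primitive c (weakDeriv f) :=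
  h.weakDeriv_spec.2.ae_eq_primitive (integrable_of_memLp h.1)
    (integrable_of_memLp h.weakDeriv_spec.1)

theorem MemH1.eqOn_primitive {f : ℝ → ℝ} (h : MemH1 f) (hf : ContinuousOn f (Icc 0 1)) :
    EqOn f (primitive (f 0) (weakDeriv f)) (Icc 0 1) := by
  obtain ⟨c, hc⟩ := h.ae_eq_primitive
  have e := eqOn_of_ae_eq hf
    (continuousOn_primitive (integrable_of_memLp h.weakDeriv_spec.1) c) hc
  have : f 0 = c := by rw [e (by simp), primitive_zero]
  rwa [this]

theorem memH1_of_hasWeakDeriv {f g : ℝ → ℝ} (hf : MemLp f 2 vol01) (hg : MemLp g 2 vol01)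
    (h : HasWeakDeriv f g) : MemH1 f ∧ weakDeriv f =ᵐ[vol01] g := by
  have hm : MemH1 f := ⟨hf, g, hg, h⟩
  exact ⟨hm, hm.weakDeriv_spec.2.unique (integrable_of_memLp hm.weakDeriv_spec.1)
    (integrable_of_memLp hg) h⟩

theorem memH1_of_hasDerivAt {f g : ℝ → ℝ} (hg : ContinuousOn g (Icc 0 1))
    (h : ∀ x ∈ Icc (0 : ℝ) 1, HasDerivAt f (g x) x) : MemH1 f ∧ weakDeriv f =ᵐ[vol01] g := by
  have hf : ContinuousOn f (Icc 0 1) := fun x hx => (h x hx).continuousAt.continuousWithinAt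
  refine memH1_of_hasWeakDeriv (memLp_vol01_of_continuousOn hf) (memLp_vol01_of_continuousOn hg) ?_
  refine (hasWeakDeriv_primitive (integrable_vol01_of_continuousOn hg) (f 0)).congr ?_ (ae_eq_refl _)
  exact ae_vol01_mem.mono fun x hx => (primitive_eq_of_hasDerivAt hg h hx).symm

/-- Integration by parts of an `H¹` function against a `C¹` function vanishing at the end points. -/
theorem MemH1.integral_by_parts {v q q' : ℝ → ℝ} (hv : MemH1 v) (hq' : ContinuousOn q' (Icc 0 1))
    (hq : ∀ x ∈ Icc (0 : ℝ) 1, HasDerivAt q (q' x) x) (h0 : q 0 = 0) (h1 : q 1 = 0) :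
    ∫ x, q x * weakDeriv v x ∂vol01 = -∫ x, q' x * v x ∂vol01 := by
  obtain ⟨c, hc⟩ := hv.ae_eq_primitive
  have e := primitive_eq_of_hasDerivAt hq' hq
  have key := primitive_integral_by_parts (integrable_of_memLp hv.weakDeriv_spec.1)
    (integrable_vol01_of_continuousOn hq') c (q 0)
  rw [← e (by simp), h1, h0] at key
  have e1 : ∫ x, q' x * v x ∂vol01 = ∫ x, primitive c (weakDeriv v) x * q' x ∂vol01 :=
    integral_congr_ae (hc.mono fun x hx => by simp only [hx]; ring)
  have e2 : ∫ x, q x * weakDeriv v x ∂vol01 =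
      ∫ x, weakDeriv v x * primitive 0 q' x ∂vol01 :=
    integral_congr_ae (ae_vol01_mem.mono fun x hx => by
      have := e hx
      rw [h0] at this
      simp only [this]; ring)
  rw [e1, e2, key]; ring

/-! ### Scalar linear differential equations -/

theorem continuous_primitive {g : ℝ → ℝ} (hg : Continuous g) (c : ℝ) :
    Continuous (primitive c g) :=
  continuous_iff_continuousAt.2 fun x => (hasDerivAt_primitive hg c x).continuousAt

theorem abs_primitive_zero_le {g : ℝ → ℝ} {C : ℝ} (hC : ∀ x ∈ Icc (0 : ℝ) 1, |g x| ≤ C) {x : ℝ}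
    (hx : x ∈ Icc (0 : ℝ) 1) : |primitive 0 g x| ≤ C := by
  have h0 : 0 ≤ C := (abs_nonneg _).trans (hC 0 (by simp))
  have := intervalIntegral.norm_integral_le_of_norm_le_const (f := g) (a := 0) (b := x) (C := C)
    (fun t ht => by
      rw [uIoc_of_le hx.1] at ht
      exact hC t ⟨ht.1.le, ht.2.trans hx.2⟩)
  rw [Real.norm_eq_abs, sub_zero, abs_of_nonneg hx.1] at this
  rw [primitive, zero_add]
  exact this.trans (mul_le_of_le_one_right h0 hx.2)

/-- Variation of constants for `δ' = k δ + h`. -/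
theorem eq_of_linear_ode {δ k h : ℝ → ℝ} (hk : Continuous k) (hh : Continuous h)
    (hδ : ∀ x ∈ Icc (0 : ℝ) 1, HasDerivAt δ (k x * δ x + h x) x) {x : ℝ} (hx : x ∈ Icc (0 : ℝ) 1) :
    δ x = Real.exp (primitive 0 k x) *
      primitive (δ 0) (fun t => h t * Real.exp (-primitive 0 k t)) x := by
  have hc : Continuous fun t => h t * Real.exp (-primitive 0 k t) :=
    hh.mul (Real.continuous_exp.comp (continuous_primitive hk 0).neg)
  have key := primitive_eq_of_hasDerivAt (f := fun t => δ t * Real.exp (-primitive 0 k t))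
    hc.continuousOn (fun t ht => by
      have := (hδ t ht).mul (hasDerivAt_primitive hk 0 t).fun_neg.exp
      convert! this using 1
      ring) hx
  simp only [primitive_zero, neg_zero, Real.exp_zero, mul_one] at key
  rw [← key, mul_left_comm, ← Real.exp_add, add_neg_cancel, Real.exp_zero, mul_one]

theorem eq_of_homogeneous_linear_ode {δ k : ℝ → ℝ} (hk : Continuous k)
    (hδ : ∀ x ∈ Icc (0 : ℝ) 1, HasDerivAt δ (k x * δ x) x) {x : ℝ} (hx : x ∈ Icc (0 : ℝ) 1) :
    δ x = δ 0 * Real.exp (primitive 0 k x) := by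
  have := eq_of_linear_ode (h := fun _ => 0) hk continuous_const
    (fun t ht => by simpa using hδ t ht) hx
  simpa [primitive, mul_comm] using this

/-- In the variation of constants formula the inner and the outer exponential each cost at most `exp
κ`, whence `2 * κ`. -/
theorem linear_ode_le {δ k h : ℝ → ℝ} (hk : Continuous k) (hh : Continuous h)
    (hδ : ∀ x ∈ Icc (0 : ℝ) 1, HasDerivAt δ (k x * δ x + h x) x) (h0 : δ 0 = 0) {κ H : ℝ}
    (hκ : ∀ x ∈ Icc (0 : ℝ) 1, |k x| ≤ κ) (hp : ∀ x ∈ Icc (0 : ℝ) 1, 0 ≤ h x)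
    (hH : ∀ x ∈ Icc (0 : ℝ) 1, h x ≤ H) : 0 ≤ δ 1 ∧ δ 1 ≤ H * Real.exp (2 * κ) := by
  have hx1 : (1 : ℝ) ∈ Icc (0 : ℝ) 1 := by simp
  have hH0 : 0 ≤ H := (hp 1 hx1).trans (hH 1 hx1)
  rw [eq_of_linear_ode hk hh hδ hx1, h0]
  have hn : 0 ≤ primitive 0 (fun t => h t * Real.exp (-primitive 0 k t)) 1 := by
    rw [primitive, zero_add]
    exact intervalIntegral.integral_nonneg zero_le_one fun t ht =>
      mul_nonneg (hp t ht) (Real.exp_pos _).le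
  have hu : primitive 0 (fun t => h t * Real.exp (-primitive 0 k t)) 1 ≤ H * Real.exp κ := by
    refine (le_abs_self _).trans (abs_primitive_zero_le (fun t ht => ?_) hx1)
    rw [abs_mul, Real.abs_exp, abs_of_nonneg (hp t ht)]
    refine mul_le_mul (hH t ht) (Real.exp_le_exp.2 ?_) (Real.exp_pos _).le hH0
    exact (neg_le_abs _).trans (abs_primitive_zero_le hκ ht)
  refine ⟨mul_nonneg (Real.exp_pos _).le hn, ?_⟩
  have he : Real.exp (primitive 0 k 1) ≤ Real.exp κ :=
    Real.exp_le_exp.2 ((le_abs_self _).trans (abs_primitive_zero_le hκ hx1))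
  calc _ ≤ Real.exp κ * (H * Real.exp κ) := mul_le_mul he hu hn (Real.exp_pos _).le
    _ = H * Real.exp (2 * κ) := by rw [two_mul, Real.exp_add]; ring

/-- Strict positivity of the forcing is asked at `0` only: for Prüfer angles it carries a factor
`cos²`, which is `1` at `0` but may vanish later. -/
theorem linear_ode_pos {δ k h : ℝ → ℝ} (hk : Continuous k) (hh : Continuous h)
    (hδ : ∀ x ∈ Icc (0 : ℝ) 1, HasDerivAt δ (k x * δ x + h x) x) (h0 : δ 0 = 0)
    (hp : ∀ x ∈ Icc (0 : ℝ) 1, 0 ≤ h x) (hpos : 0 < h 0) : 0 < δ 1 := by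
  rw [eq_of_linear_ode hk hh hδ (by simp), h0]
  refine mul_pos (Real.exp_pos _) ?_
  rw [primitive, zero_add]
  refine (intervalIntegral.integral_pos zero_lt_one ?_ ?_ ?_)
  · exact (hh.mul (Real.continuous_exp.comp (continuous_primitive hk 0).neg)).continuousOn
  · exact fun t ht => mul_nonneg (hp t (Ioc_subset_Icc_self ht)) (Real.exp_pos _).le
  · exact ⟨0, by simp, mul_pos hpos (Real.exp_pos _)⟩

/-! ### Prüfer angles: existence, comparison, amplitude -/

theorem sin_sq_sub_sin_sq (x y : ℝ) :
    Real.sin x ^ 2 - Real.sin y ^ 2 = Real.sin (x - y) * Real.sin (x + y) := by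
  rw [Real.sin_add, Real.sin_sub]
  linear_combination (-Real.sin x ^ 2) * Real.sin_sq_add_cos_sq y +
    Real.sin y ^ 2 * Real.sin_sq_add_cos_sq x

/-- `θ` is the Prüfer angle with `θ(0) = 0` of the system `u' = a z`, `z' = -b u` on `[0,1]`. -/
structure IsPrueferAngle (a b θ : ℝ → ℝ) : Prop where
  continuous : Continuous θ
  zero : θ 0 = 0
  hasDerivAt : ∀ x ∈ Icc (0 : ℝ) 1,
    HasDerivAt θ (a x * Real.sin (θ x) ^ 2 + b x * Real.cos (θ x) ^ 2) x

/-- The right-hand side is bounded and globally Lipschitz in the angle, both with constant `A + B`,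
so one Picard–Lindelöf step covers all of `[0,1]`. -/
theorem exists_isPrueferAngle {a b : ℝ → ℝ} (ha : Continuous a) (hb : Continuous b) :
    ∃ θ, IsPrueferAngle a b θ := by
  obtain ⟨A, hA⟩ := isCompact_Icc.exists_bound_of_continuousOn (ha.continuousOn (s := Icc (0 : ℝ) 1))
  obtain ⟨B, hB⟩ := isCompact_Icc.exists_bound_of_continuousOn (hb.continuousOn (s := Icc (0 : ℝ) 1))
  have hA0 : 0 ≤ A := (norm_nonneg _).trans (hA 0 (by simp))
  have hB0 : 0 ≤ B := (norm_nonneg _).trans (hB 0 (by simp))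
  set M : ℝ≥0 := ⟨A + B, by positivity⟩ with hM
  let f : ℝ → ℝ → ℝ := fun t y => a t * Real.sin y ^ 2 + b t * Real.cos y ^ 2
  have hf : IsPicardLindelof f (⟨0, by simp⟩ : Icc (0 : ℝ) 1) (0 : ℝ) M 0 M M := by
    refine ⟨fun t ht => LipschitzOnWith.of_dist_le_mul fun x _ y _ => ?_, fun x _ => ?_,
      fun t ht x _ => ?_, by simp⟩
    · have e : f t x - f t y = (a t - b t) * (Real.sin (x - y) * Real.sin (x + y)) := by
        rw [← sin_sq_sub_sin_sq]
        simp only [f, Real.cos_sq']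
        ring
      rw [Real.dist_eq, Real.dist_eq, e, abs_mul, abs_mul]
      refine mul_le_mul ((abs_sub _ _).trans (add_le_add (hA t ht) (hB t ht))) ?_
        (by positivity) M.2
      calc |Real.sin (x - y)| * |Real.sin (x + y)| ≤ |x - y| * 1 :=
            mul_le_mul Real.abs_sin_le_abs (Real.abs_sin_le_one _) (abs_nonneg _) (abs_nonneg _)
        _ = _ := mul_one _
    · exact (by fun_prop : Continuous fun t => f t x).continuousOn
    · refine (norm_add_le _ _).trans (add_le_add ?_ ?_)
      · rw [norm_mul]
        refine (mul_le_of_le_one_right (norm_nonneg _) ?_).trans (hA t ht)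
        rw [Real.norm_eq_abs, abs_of_nonneg (sq_nonneg _)]; exact Real.sin_sq_le_one x
      · rw [norm_mul]
        refine (mul_le_of_le_one_right (norm_nonneg _) ?_).trans (hB t ht)
        rw [Real.norm_eq_abs, abs_of_nonneg (sq_nonneg _)]; exact Real.cos_sq_le_one x
  obtain ⟨z, hz0, hz⟩ := hf.exists_eq_forall_mem_Icc_hasDerivWithinAt₀
  have hzc : ContinuousOn z (Icc 0 1) := fun t ht => (hz t ht).continuousWithinAt
  -- Picard–Lindelöf gives only one-sided derivatives at the end points. Extending the solution by
  -- constants and integrating the right-hand side again gives two-sided ones.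
  set y : ℝ → ℝ := IccExtend zero_le_one ((Icc (0 : ℝ) 1).domRestrict z) with hy
  have hyc : Continuous y := hzc.domRestrict.Icc_extend'
  have hyz : ∀ t ∈ Icc (0 : ℝ) 1, y t = z t := fun t ht => by
    rw [hy, IccExtend_of_mem _ _ ht]; rfl
  have hg : Continuous fun t => f t (y t) := by fun_prop
  have hθz : ∀ x ∈ Icc (0 : ℝ) 1, primitive 0 (fun t => f t (y t)) x = z x := fun x hx => by
    rw [primitive, zero_add, intervalIntegral.integral_eq_sub_of_hasDerivAt_of_le hx.1
      (hzc.mono (Icc_subset_Icc_right hx.2)) (fun t ht => ?_) (hg.intervalIntegrable _ _)]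
    · change z 0 = 0 at hz0
      rw [hz0, sub_zero]
    · have ht' : t ∈ Icc (0 : ℝ) 1 := ⟨ht.1.le, ht.2.le.trans hx.2⟩
      rw [hyz t ht']
      exact (hz t ht').hasDerivAt (Icc_mem_nhds ht.1 (ht.2.trans_le hx.2))
  refine ⟨_, continuous_primitive hg 0, primitive_zero _ _, fun x hx => ?_⟩
  have := hasDerivAt_primitive hg 0 x
  rw [hθz x hx, ← hyz x hx]
  exact this

namespace IsPrueferAngle

/-- The factorisation of `sin² θ' - sin² θ` turns the difference of two angles into a solution of a
linear equation. `Real.sinc` divides `sin (θ' - θ)` by `θ' - θ` continuously, also where the angles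
meet. -/
theorem sub_hasDerivAt {a b b' θ θ' : ℝ → ℝ} (h : IsPrueferAngle a b θ)
    (h' : IsPrueferAngle a b' θ') {x : ℝ} (hx : x ∈ Icc (0 : ℝ) 1) :
    HasDerivAt (fun x => θ' x - θ x)
      ((a x - b x) * Real.sinc (θ' x - θ x) * Real.sin (θ' x + θ x) * (θ' x - θ x) +
        (b' x - b x) * Real.cos (θ' x) ^ 2) x := by
  convert! (h'.hasDerivAt x hx).sub (h.hasDerivAt x hx) using 1
  have e1 : Real.sinc (θ' x - θ x) * (θ' x - θ x) = Real.sin (θ' x - θ x) := by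
    by_cases hz : θ' x - θ x = 0
    · simp [hz]
    · rw [Real.sinc_of_ne_zero hz, div_mul_cancel₀ _ hz]
  have e2 := sin_sq_sub_sin_sq (θ' x) (θ x)
  rw [← e1] at e2
  rw [Real.cos_sq' (θ' x), Real.cos_sq' (θ x)]
  linear_combination -(a x - b x) * e2

/-- Monotone and Lipschitz dependence on `b`: in the linear equation for `θ' - θ` the coefficient is
at most `κ` in absolute value and the forcing lies in `[0, H]`. Only the smaller coefficient `b`
enters `κ`. -/
theorem sub_le {a b b' θ θ' : ℝ → ℝ} (ha : Continuous a) (hb : Continuous b) (hb' : Continuous b')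
    (h : IsPrueferAngle a b θ) (h' : IsPrueferAngle a b' θ') {κ H : ℝ}
    (hκ : ∀ x ∈ Icc (0 : ℝ) 1, |a x - b x| ≤ κ) (hp : ∀ x ∈ Icc (0 : ℝ) 1, b x ≤ b' x)
    (hH : ∀ x ∈ Icc (0 : ℝ) 1, b' x - b x ≤ H) :
    θ 1 ≤ θ' 1 ∧ θ' 1 - θ 1 ≤ H * Real.exp (2 * κ) := by
  have hθ := h.continuous
  have hθ' := h'.continuous
  have hs : Continuous fun x => Real.sinc (θ' x - θ x) :=
    Real.continuous_sinc.comp (hθ'.sub hθ)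
  have key := linear_ode_le (κ := κ) (H := H) (by fun_prop) (by fun_prop)
    (fun x hx => h.sub_hasDerivAt h' hx) (by simp [h.zero, h'.zero]) (fun x hx => ?_)
    (fun x hx => mul_nonneg (sub_nonneg.2 (hp x hx)) (sq_nonneg _)) fun x hx =>
      (mul_le_of_le_one_right (sub_nonneg.2 (hp x hx)) (Real.cos_sq_le_one _)).trans (hH x hx)
  · exact ⟨sub_nonneg.1 key.1, key.2⟩
  · rw [abs_mul, abs_mul]
    refine (mul_le_of_le_one_right (by positivity) (Real.abs_sin_le_one _)).trans ?_
    exact (mul_le_of_le_one_right (by positivity) (Real.abs_sinc_le_one _)).trans (hκ x hx)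

theorem lt {a b b' θ θ' : ℝ → ℝ} (ha : Continuous a) (hb : Continuous b) (hb' : Continuous b')
    (h : IsPrueferAngle a b θ) (h' : IsPrueferAngle a b' θ')
    (hp : ∀ x ∈ Icc (0 : ℝ) 1, b x < b' x) : θ 1 < θ' 1 := by
  have hθ := h.continuous
  have hθ' := h'.continuous
  have hs : Continuous fun x => Real.sinc (θ' x - θ x) :=
    Real.continuous_sinc.comp (hθ'.sub hθ)
  refine sub_pos.1 (linear_ode_pos (by fun_prop) (by fun_prop)
    (fun x hx => h.sub_hasDerivAt h' hx) (by simp [h.zero, h'.zero])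
    (fun x hx => mul_nonneg (sub_nonneg.2 (hp x hx).le) (sq_nonneg _)) ?_)
  simpa [h'.zero] using hp 0 (by simp)

/-- A Prüfer angle grows at least at the rate by which both coefficients are bounded below. -/
theorem mul_sub_le {a b θ : ℝ → ℝ} (h : IsPrueferAngle a b θ) {k : ℝ}
    (ha : ∀ x ∈ Icc (0 : ℝ) 1, k ≤ a x) (hb : ∀ x ∈ Icc (0 : ℝ) 1, k ≤ b x) {x y : ℝ}
    (hx : 0 ≤ x) (hxy : x ≤ y) (hy : y ≤ 1) : k * (y - x) ≤ θ y - θ x := by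
  refine (convex_Icc (0 : ℝ) 1).mul_sub_le_image_sub_of_le_deriv h.continuous.continuousOn
    (fun t ht => ?_) (fun t ht => ?_) x ⟨hx, hxy.trans hy⟩ y ⟨hx.trans hxy, hy⟩ hxy
  · exact (h.hasDerivAt t (interior_subset ht)).differentiableAt.differentiableWithinAt
  · have ht' := interior_subset ht
    rw [(h.hasDerivAt t ht').deriv]
    calc k = k * Real.sin (θ t) ^ 2 + k * Real.cos (θ t) ^ 2 := by
          rw [← mul_add, Real.sin_sq_add_cos_sq, mul_one]
      _ ≤ _ := add_le_add (mul_le_mul_of_nonneg_right (ha t ht') (sq_nonneg _))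
          (mul_le_mul_of_nonneg_right (hb t ht') (sq_nonneg _))

/-- The logarithm of the Prüfer amplitude. -/
def logAmplitude (a b θ : ℝ → ℝ) : ℝ → ℝ :=
  primitive 0 fun x => (b x - a x) * (Real.sin (θ x) * Real.cos (θ x))

variable {a b θ : ℝ → ℝ}

theorem logAmplitude_hasDerivAt (ha : Continuous a) (hb : Continuous b)
    (h : IsPrueferAngle a b θ) (x : ℝ) :
    HasDerivAt (logAmplitude a b θ) ((b x - a x) * (Real.sin (θ x) * Real.cos (θ x))) x := by
  have hθ := h.continuous
  exact hasDerivAt_primitive (by fun_prop) 0 x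

theorem abs_logAmplitude_le {κ : ℝ} (hκ : ∀ x ∈ Icc (0 : ℝ) 1, |a x - b x| ≤ κ) {x : ℝ}
    (hx : x ∈ Icc (0 : ℝ) 1) : |logAmplitude a b θ x| ≤ κ := by
  refine abs_primitive_zero_le (fun t ht => ?_) hx
  rw [abs_mul, abs_sub_comm, abs_mul]
  refine (mul_le_of_le_one_right (abs_nonneg _) ?_).trans (hκ t ht)
  exact mul_le_one₀ (Real.abs_sin_le_one _) (abs_nonneg _) (Real.abs_cos_le_one _)

/-- Together with `sin_hasDerivAt` this shows that the polar pair solves `u' = a z`, `z' = -b u`. -/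
theorem cos_hasDerivAt (ha : Continuous a) (hb : Continuous b) (h : IsPrueferAngle a b θ) {x : ℝ}
    (hx : x ∈ Icc (0 : ℝ) 1) :
    HasDerivAt (fun x => Real.exp (logAmplitude a b θ x) * Real.cos (θ x))
      (a x * -(Real.exp (logAmplitude a b θ x) * Real.sin (θ x))) x := by
  convert! (h.logAmplitude_hasDerivAt ha hb x).exp.fun_mul (h.hasDerivAt x hx).cos using 1
  linear_combination (a x * Real.exp (logAmplitude a b θ x) * Real.sin (θ x)) *
    Real.sin_sq_add_cos_sq (θ x)

theorem sin_hasDerivAt (ha : Continuous a) (hb : Continuous b) (h : IsPrueferAngle a b θ) {x : ℝ}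
    (hx : x ∈ Icc (0 : ℝ) 1) :
    HasDerivAt (fun x => -(Real.exp (logAmplitude a b θ x) * Real.sin (θ x)))
      (-b x * (Real.exp (logAmplitude a b θ x) * Real.cos (θ x))) x := by
  convert! ((h.logAmplitude_hasDerivAt ha hb x).exp.fun_mul (h.hasDerivAt x hx).sin).fun_neg using 1
  linear_combination (b x * Real.exp (logAmplitude a b θ x) * Real.cos (θ x)) *
    Real.sin_sq_add_cos_sq (θ x)

/-- A solution of `u' = a z`, `z' = -b u`, `z(0) = 0` is determined by `u(0)` and the Prüfer
angle. -/
theorem eq_of_system (ha : Continuous a) (hb : Continuous b) (h : IsPrueferAngle a b θ)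
    {u z : ℝ → ℝ} (hu : ∀ x ∈ Icc (0 : ℝ) 1, HasDerivAt u (a x * z x) x)
    (hz : ∀ x ∈ Icc (0 : ℝ) 1, HasDerivAt z (-b x * u x) x) (hz0 : z 0 = 0) {x : ℝ}
    (hx : x ∈ Icc (0 : ℝ) 1) :
    u x = u 0 * (Real.exp (logAmplitude a b θ x) * Real.cos (θ x)) ∧
      z x = u 0 * -(Real.exp (logAmplitude a b θ x) * Real.sin (θ x)) := by
  have hθ := h.continuous
  -- The component of `(u, z)` transverse to `(cos θ, -sin θ)` solves a homogeneous linear equation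
  -- and vanishes at `0`, hence everywhere.
  have hτ : ∀ x ∈ Icc (0 : ℝ) 1, u x * Real.sin (θ x) + z x * Real.cos (θ x) = 0 := by
    intro x hx
    have := eq_of_homogeneous_linear_ode
      (δ := fun x => u x * Real.sin (θ x) + z x * Real.cos (θ x))
      (k := fun x => (a x - b x) * (Real.sin (θ x) * Real.cos (θ x))) (by fun_prop)
      (fun x hx => by
        convert! ((hu x hx).fun_mul (h.hasDerivAt x hx).sin).fun_add
          ((hz x hx).fun_mul (h.hasDerivAt x hx).cos) using 1
        have e := Real.sin_sq_add_cos_sq (θ x)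
        generalize Real.sin (θ x) = S at *
        generalize Real.cos (θ x) = C at *
        linear_combination (a x * z x * S - b x * u x * C) * e) hx
    simpa [h.zero, hz0] using this
  -- Once the transverse component is zero, the component along `(cos θ, -sin θ)` grows exactly like
  -- the amplitude.
  have hρ := eq_of_homogeneous_linear_ode
    (δ := fun x => u x * Real.cos (θ x) - z x * Real.sin (θ x))
    (k := fun x => (b x - a x) * (Real.sin (θ x) * Real.cos (θ x))) (by fun_prop)
    (fun x hx => by
      convert! ((hu x hx).fun_mul (h.hasDerivAt x hx).cos).fun_sub
        ((hz x hx).fun_mul (h.hasDerivAt x hx).sin) using 1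
      have e := Real.sin_sq_add_cos_sq (θ x)
      have t := hτ x hx
      generalize Real.sin (θ x) = S at *
      generalize Real.cos (θ x) = C at *
      linear_combination (a x * (S ^ 2 - C ^ 2) + b x * (C ^ 2 - S ^ 2)) * t +
        (a x * C * z x + b x * S * u x) * e) hx
  simp only [h.zero, Real.cos_zero, Real.sin_zero, mul_one, mul_zero, sub_zero] at hρ
  have t := hτ x hx
  have e := Real.sin_sq_add_cos_sq (θ x)
  rw [logAmplitude, ← mul_assoc, ← hρ, mul_neg, ← mul_assoc, ← hρ]
  constructor
  · linear_combination Real.sin (θ x) * t - u x * e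
  · linear_combination Real.cos (θ x) * t - z x * e

end IsPrueferAngle

/-! ### The weak eigenvalue problem as a first order system -/

/-- `p` and `m` are bounded continuous functions on the line that extend `σ² μ` and `μ`. -/
structure IsExtension (σ μ p m : ℝ → ℝ) (l L k K : ℝ) : Prop where
  continuous_p : Continuous p
  continuous_m : Continuous m
  l_pos : 0 < l
  k_pos : 0 < k
  le_p : ∀ x, l ≤ p x
  p_le : ∀ x, p x ≤ L
  le_m : ∀ x, k ≤ m x
  m_le : ∀ x, m x ≤ K
  p_eq : ∀ x ∈ Icc (0 : ℝ) 1, p x = σ x ^ 2 * μ x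
  m_eq : ∀ x ∈ Icc (0 : ℝ) 1, m x = μ x

/-- The first order system `u' = q / p`, `q' = -2 lam m u` with `q(0) = q(1) = 0`. -/
structure IsSolution (p m : ℝ → ℝ) (lam : ℝ) (u q : ℝ → ℝ) : Prop where
  hasDerivAt_u : ∀ x ∈ Icc (0 : ℝ) 1, HasDerivAt u (q x / p x) x
  hasDerivAt_q : ∀ x ∈ Icc (0 : ℝ) 1, HasDerivAt q (-(2 * lam * m x * u x)) x
  zero : q 0 = 0
  one : q 1 = 0

theorem IsSolution.continuousOn_u {p m u q : ℝ → ℝ} {lam : ℝ} (h : IsSolution p m lam u q) :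
    ContinuousOn u (Icc 0 1) :=
  fun x hx => (h.hasDerivAt_u x hx).continuousAt.continuousWithinAt

theorem IsSolution.continuousOn_q {p m u q : ℝ → ℝ} {lam : ℝ} (h : IsSolution p m lam u q) :
    ContinuousOn q (Icc 0 1) :=
  fun x hx => (h.hasDerivAt_q x hx).continuousAt.continuousWithinAt

variable {σ μ p m : ℝ → ℝ} {l L k K : ℝ}

namespace IsExtension

theorem p_pos (h : IsExtension σ μ p m l L k K) (x : ℝ) : 0 < p x := h.l_pos.trans_le (h.le_p x)

theorem m_pos (h : IsExtension σ μ p m l L k K) (x : ℝ) : 0 < m x := h.k_pos.trans_le (h.le_m x)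

/-- Compactly supported test functions show that `p w'` has weak derivative `-2 λ m w`, so it agrees
almost everywhere with a `C¹` flux `q`. Test functions that do not vanish at the end points then
give the natural boundary conditions. -/
theorem exists_isSolution (h : IsExtension σ μ p m l L k K) {lam : ℝ} {w : ℝ → ℝ}
    (hw : IsEigenpair σ μ lam w) : ∃ u q, EqOn w u (Icc 0 1) ∧ IsSolution p m lam u q := by
  set we : ℝ → ℝ := IccExtend zero_le_one ((Icc (0 : ℝ) 1).domRestrict w) with hwe
  have cwe : Continuous we := hw.continuousOn.domRestrict.Icc_extend'
  have ewe : ∀ t ∈ Icc (0 : ℝ) 1, we t = w t := fun t ht => by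
    rw [hwe, IccExtend_of_mem _ _ ht]; rfl
  have cm := h.continuous_m
  have cp := h.continuous_p
  have iw : Integrable (weakDeriv w) vol01 := integrable_of_memLp hw.memH1.weakDeriv_spec.1
  set q' : ℝ → ℝ := fun x => -(2 * lam * m x * we x) with hq'
  have cq' : Continuous q' := by fun_prop
  have weak : ∀ v v' : ℝ → ℝ, Continuous v' → (∀ x, HasDerivAt v (v' x) x) →
      ∫ x, weakDeriv w x * p x * v' x ∂vol01 = -∫ x, q' x * v x ∂vol01 := by
    intro v v' cv hv
    obtain ⟨h1, h2⟩ := memH1_of_hasDerivAt cv.continuousOn fun x _ => hv x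
    have e := hw.weak_eq v h1
    have e1 : ∫ x, weakDeriv w x * p x * v' x ∂vol01 =
        ∫ x, weakDeriv w x * weakDeriv v x * σ x ^ 2 * μ x ∂vol01 := by
      refine integral_congr_ae ?_
      filter_upwards [h2, ae_vol01_mem] with x hx hx1
      rw [hx, h.p_eq x hx1]; ring
    have e2 : ∫ x, q' x * v x ∂vol01 = -(2 * lam * ∫ x, w x * v x * μ x ∂vol01) := by
      rw [← integral_const_mul, ← integral_neg]
      refine integral_congr_ae ?_
      filter_upwards [ae_vol01_mem] with x hx1
      simp only [hq', ewe x hx1, h.m_eq x hx1]; ring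
    rw [e1, e2, e, neg_neg]
  obtain ⟨c, hc⟩ := HasWeakDeriv.ae_eq_primitive (integrable_mul_continuous iw cp.continuousOn)
    (integrable_vol01_of_continuousOn cq'.continuousOn) (fun φ h1 h2 h3 =>
      weak φ (deriv φ) (h1.continuous_deriv (by simp)) fun x =>
        (h1.differentiable (by simp) x).hasDerivAt)
  set q := primitive c q' with hq
  have dq : ∀ x, HasDerivAt q (q' x) x := hasDerivAt_primitive cq' c
  have cq : Continuous q := continuous_primitive cq' c
  have cqp : Continuous fun x => q x / p x := cq.div cp fun x => (h.p_pos x).ne'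
  have ew : EqOn w (primitive (w 0) fun x => q x / p x) (Icc 0 1) := by
    refine (hw.memH1.eqOn_primitive hw.continuousOn).trans (primitive_congr ?_)
    filter_upwards [hc] with x hx
    rw [← hx, mul_div_cancel_right₀ _ (h.p_pos x).ne']
  -- After integration by parts only the boundary terms survive; `v = x` and then `v = 1` are
  -- inserted below.
  have bd : ∀ v v' : ℝ → ℝ, Continuous v' → (∀ x, HasDerivAt v (v' x) x) →
      q 1 * v 1 = q 0 * v 0 := by
    intro v v' cv hv
    have e1 := weak v v' cv hv
    have ev := primitive_eq_of_hasDerivAt cv.continuousOn fun x _ => hv x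
    have e2 := primitive_integral_by_parts (integrable_vol01_of_continuousOn cq'.continuousOn)
      (integrable_vol01_of_continuousOn cv.continuousOn) c (v 0)
    rw [← ev (by simp), ← hq] at e2
    have e3 : ∫ x, weakDeriv w x * p x * v' x ∂vol01 = ∫ x, q x * v' x ∂vol01 :=
      integral_congr_ae (hc.mono fun x hx => by simp only [hx])
    have e4 : ∫ x, q' x * v x ∂vol01 = ∫ x, q' x * primitive (v 0) v' x ∂vol01 :=
      integral_congr_ae (ae_vol01_mem.mono fun x hx => by simp only [ev hx])
    have e5 : q 0 = c := primitive_zero c q'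
    rw [e5]; linarith
  have b1 : q 1 = 0 := by simpa using bd (fun x => x) (fun _ => 1) continuous_const hasDerivAt_id'
  have b0 : q 0 = 0 := by
    simpa [b1] using (bd (fun _ => 1) (fun _ => 0) continuous_const fun x => hasDerivAt_const x 1).symm
  refine ⟨_, q, ew, fun x _ => hasDerivAt_primitive cqp (w 0) x, fun x hx => ?_, b0, b1⟩
  rw [← ew hx, ← ewe x hx]
  exact dq x

/-- Integrating `q v'` by parts for `v` in `H¹` leaves no boundary terms, because `q` vanishes at
both ends. -/
theorem isEigenpair (h : IsExtension σ μ p m l L k K) {lam : ℝ} {u q : ℝ → ℝ}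
    (hu : IsSolution p m lam u q) (hne : u 0 ≠ 0) : IsEigenpair σ μ lam u := by
  have cqp : ContinuousOn (fun x => q x / p x) (Icc 0 1) :=
    hu.continuousOn_q.div h.continuous_p.continuousOn fun x _ => (h.p_pos x).ne'
  obtain ⟨h1, h2⟩ := memH1_of_hasDerivAt cqp hu.hasDerivAt_u
  refine ⟨h1, hu.continuousOn_u, ⟨0, by simp, hne⟩, fun v hv => ?_⟩
  have cq' : ContinuousOn (fun x => -(2 * lam * m x * u x)) (Icc 0 1) :=
    ((continuous_const.mul h.continuous_m).continuousOn.mul hu.continuousOn_u).neg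
  have key := hv.integral_by_parts cq' hu.hasDerivAt_q hu.zero hu.one
  have e1 : ∫ x, weakDeriv u x * weakDeriv v x * σ x ^ 2 * μ x ∂vol01 =
      ∫ x, q x * weakDeriv v x ∂vol01 := by
    refine integral_congr_ae ?_
    filter_upwards [h2, ae_vol01_mem] with x hx hx1
    rw [hx, mul_assoc, ← h.p_eq x hx1]
    field_simp [(h.p_pos x).ne']
  rw [e1, key, ← integral_const_mul, ← integral_neg]
  refine integral_congr_ae ?_
  filter_upwards [ae_vol01_mem] with x hx1
  rw [h.m_eq x hx1]; ring

theorem integral_sq_pos (h : IsExtension σ μ p m l L k K) {w : ℝ → ℝ}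
    (hw : ContinuousOn w (Icc 0 1)) (hne : ∃ x ∈ Icc (0 : ℝ) 1, w x ≠ 0) :
    0 < ∫ x, w x * w x * μ x ∂vol01 := by
  have : ∫ x, w x * w x * μ x ∂vol01 = ∫ x in (0 : ℝ)..1, w x * w x * m x := by
    rw [← integral_vol01]
    exact integral_congr_ae (ae_vol01_mem.mono fun x hx => by simp only [h.m_eq x hx])
  rw [this]
  obtain ⟨x, hx, hx0⟩ := hne
  exact intervalIntegral.integral_pos zero_lt_one ((hw.mul hw).mul h.continuous_m.continuousOn)
    (fun t _ => mul_nonneg (mul_self_nonneg _) (h.m_pos t).le)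
    ⟨x, hx, mul_pos (mul_self_pos.2 hx0) (h.m_pos x)⟩

theorem eigenvalue_nonneg (h : IsExtension σ μ p m l L k K) {lam : ℝ} {w : ℝ → ℝ}
    (hw : IsEigenpair σ μ lam w) : 0 ≤ lam := by
  have e := hw.weak_eq w hw.memH1
  have h1 : 0 ≤ ∫ x, weakDeriv w x * weakDeriv w x * σ x ^ 2 * μ x ∂vol01 :=
    integral_nonneg_of_ae (ae_vol01_mem.mono fun x hx => by
      have := h.m_pos x
      rw [h.m_eq x hx] at this
      change 0 ≤ weakDeriv w x * weakDeriv w x * σ x ^ 2 * μ x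
      exact mul_nonneg (mul_nonneg (mul_self_nonneg _) (sq_nonneg _)) this.le)
  have h2 := h.integral_sq_pos hw.continuousOn hw.ne_zero
  rw [e] at h1
  by_contra! hl
  nlinarith

end IsExtension

/-- Eigenfunctions with different eigenvalues are orthogonal. -/
theorem IsEigenpair.integral_mul_eq_zero {lam lam' : ℝ} {w w' : ℝ → ℝ} (h : IsEigenpair σ μ lam w)
    (h' : IsEigenpair σ μ lam' w') (hne : lam ≠ lam') : ∫ x, w x * w' x * μ x ∂vol01 = 0 := by
  have e1 := h.weak_eq w' h'.memH1
  have e2 := h'.weak_eq w h.memH1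
  simp only [mul_comm (weakDeriv w' _), mul_comm (w' _)] at e2
  have : (lam - lam') * ∫ x, w x * w' x * μ x ∂vol01 = 0 := by linarith
  exact (mul_eq_zero.1 this).resolve_left (sub_ne_zero.2 hne)

/-! ### Dependence of the Prüfer angle on the spectral parameter -/

/-- The coefficient `s / p` of the scaled Prüfer equation. -/
def fluxCoeff (p : ℝ → ℝ) (s : ℝ) (x : ℝ) : ℝ := s / p x

/-- The coefficient `2 lam m / s` of the scaled Prüfer equation. -/
def massCoeff (m : ℝ → ℝ) (s lam : ℝ) (x : ℝ) : ℝ := 2 * lam * m x / s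

open Classical in
/-- The scaled Prüfer angle with spectral parameter `lam`. -/
def angle (p m : ℝ → ℝ) (s lam : ℝ) : ℝ → ℝ :=
  if h : ∃ θ, IsPrueferAngle (fluxCoeff p s) (massCoeff m s lam) θ then h.choose else 0

/-- The scaled Prüfer amplitude with spectral parameter `lam`. -/
def amplitude (p m : ℝ → ℝ) (s lam x : ℝ) : ℝ :=
  Real.exp (IsPrueferAngle.logAmplitude (fluxCoeff p s) (massCoeff m s lam) (angle p m s lam) x)

theorem amplitude_pos (p m : ℝ → ℝ) (s lam x : ℝ) : 0 < amplitude p m s lam x := Real.exp_pos _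

theorem amplitude_zero (p m : ℝ → ℝ) (s lam : ℝ) : amplitude p m s lam 0 = 1 := by
  simp [amplitude, IsPrueferAngle.logAmplitude]

theorem continuous_massCoeff (hm : Continuous m) (s lam : ℝ) : Continuous (massCoeff m s lam) := by
  unfold massCoeff; fun_prop

namespace IsExtension

theorem continuous_fluxCoeff (h : IsExtension σ μ p m l L k K) (s : ℝ) :
    Continuous (fluxCoeff p s) :=
  continuous_const.div h.continuous_p fun x => (h.p_pos x).ne'

theorem isPrueferAngle (h : IsExtension σ μ p m l L k K) (s lam : ℝ) :
    IsPrueferAngle (fluxCoeff p s) (massCoeff m s lam) (angle p m s lam) := by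
  have := exists_isPrueferAngle (h.continuous_fluxCoeff s)
    (continuous_massCoeff h.continuous_m s lam)
  rw [angle, dif_pos this]; exact this.choose_spec

/-- This bound is the later constant `κ`; it controls both the spread of two angles and the
logarithm of the amplitude. -/
theorem abs_coeff_sub_le (h : IsExtension σ μ p m l L k K) {s lam Λ : ℝ} (hs : 0 < s)
    (h0 : 0 ≤ lam) (hΛ : lam ≤ Λ) (x : ℝ) :
    |fluxCoeff p s x - massCoeff m s lam x| ≤ s / l + 2 * Λ * K / s := by
  have hp := h.p_pos x
  have hm := h.m_pos x
  have hl := h.l_pos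
  refine (abs_sub _ _).trans (add_le_add ?_ ?_)
  · rw [fluxCoeff, abs_of_pos (div_pos hs hp)]
    exact div_le_div_of_nonneg_left hs.le hl (h.le_p x)
  · rw [massCoeff, abs_of_nonneg (by positivity)]
    have := h.m_le x
    have := h0.trans hΛ
    gcongr

theorem angle_strictMono (h : IsExtension σ μ p m l L k K) {s : ℝ} (hs : 0 < s) :
    StrictMono fun lam => angle p m s lam 1 := by
  intro lam lam' hl
  refine IsPrueferAngle.lt (h.continuous_fluxCoeff s) (continuous_massCoeff h.continuous_m s lam)
    (continuous_massCoeff h.continuous_m s lam') (h.isPrueferAngle s lam) (h.isPrueferAngle s lam')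
    fun x _ => ?_
  have := h.m_pos x
  unfold massCoeff
  gcongr

/-- At `lam = 0` the zero function is a Prüfer angle. As `angle` is obtained by choice, uniqueness
is still needed at the right end point; it is the comparison estimate with `H = 0`. -/
theorem angle_zero (h : IsExtension σ μ p m l L k K) (s : ℝ) : angle p m s 0 1 = 0 := by
  have z : IsPrueferAngle (fluxCoeff p s) (massCoeff m s 0) 0 :=
    ⟨continuous_const, rfl, fun x _ => by simp [massCoeff, hasDerivAt_zero]⟩
  obtain ⟨κ, hκ⟩ := isCompact_Icc.exists_bound_of_continuousOn (s := Icc (0 : ℝ) 1)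
    ((h.continuous_fluxCoeff s).sub (continuous_massCoeff h.continuous_m s 0)).continuousOn
  have cm := continuous_massCoeff h.continuous_m s 0
  have := IsPrueferAngle.sub_le (h.continuous_fluxCoeff s) cm cm z (h.isPrueferAngle s 0) hκ
    (fun x _ => le_rfl) (H := 0) fun x _ => (sub_self _).le
  simp only [Pi.zero_apply, zero_mul, sub_zero] at this
  exact le_antisymm this.2 this.1

/-- The mass coefficient changes by at most `2 K / s` times the change of the parameter, and the
comparison of angles adds the exponential factor. This is the source of the spectral gap. -/
theorem angle_sub_le (h : IsExtension σ μ p m l L k K) {s lam lam' Λ : ℝ} (hs : 0 < s)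
    (h0 : 0 ≤ lam) (hl : lam ≤ lam') (hΛ : lam ≤ Λ) :
    angle p m s lam' 1 - angle p m s lam 1 ≤
      2 * K / s * Real.exp (2 * (s / l + 2 * Λ * K / s)) * (lam' - lam) := by
  have := (IsPrueferAngle.sub_le (h.continuous_fluxCoeff s)
    (continuous_massCoeff h.continuous_m s lam) (continuous_massCoeff h.continuous_m s lam')
    (h.isPrueferAngle s lam) (h.isPrueferAngle s lam')
    (fun x _ => h.abs_coeff_sub_le hs h0 hΛ x) (H := 2 * K / s * (lam' - lam)) (fun x _ => ?_)
    fun x _ => ?_).2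
  · linarith
  · have := h.m_pos x
    unfold massCoeff
    gcongr
  · have e : massCoeff m s lam' x - massCoeff m s lam x = 2 * m x / s * (lam' - lam) := by
      unfold massCoeff; ring
    rw [e]
    have := h.m_le x
    have := sub_nonneg.2 hl
    gcongr

theorem continuousOn_angle (h : IsExtension σ μ p m l L k K) {s : ℝ} (hs : 0 < s) (Λ : ℝ) :
    ContinuousOn (fun lam => angle p m s lam 1) (Icc 0 Λ) := by
  have hK : 0 < K := (h.m_pos 0).trans_le (h.m_le 0)
  set C := 2 * K / s * Real.exp (2 * (s / l + 2 * Λ * K / s))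
  have hC : 0 ≤ C := by positivity
  refine LipschitzOnWith.continuousOn (K := ⟨C, hC⟩) (LipschitzOnWith.of_dist_le_mul ?_)
  have key : ∀ x ∈ Icc 0 Λ, ∀ y ∈ Icc 0 Λ, x ≤ y →
      dist (angle p m s x 1) (angle p m s y 1) ≤ C * dist x y := by
    intro x hx y hy hxy
    rw [dist_comm, dist_comm x, Real.dist_eq, Real.dist_eq,
      abs_of_nonneg (sub_nonneg.2 ((h.angle_strictMono hs).monotone hxy)),
      abs_of_nonneg (sub_nonneg.2 hxy)]
    exact h.angle_sub_le hs hx.1 hxy hx.2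
  intro x hx y hy
  rcases le_total x y with hxy | hxy
  · exact key x hx y hy hxy
  · rw [dist_comm, dist_comm x]; exact key y hy x hx hxy

theorem exists_angle_eq (h : IsExtension σ μ p m l L k K) {s : ℝ} (hs : 0 < s) {Λ c : ℝ}
    (hΛ : 0 ≤ Λ) (hc : 0 ≤ c) (hc' : c ≤ angle p m s Λ 1) :
    ∃ lam ∈ Icc 0 Λ, angle p m s lam 1 = c :=
  intermediate_value_Icc hΛ (h.continuousOn_angle hs Λ) ⟨by rwa [h.angle_zero s], hc'⟩

/-! ### Eigenvalues read off from the angle at the right end point -/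

/-- Eigenfunctions in Prüfer form. -/
theorem exists_pruefer_form (h : IsExtension σ μ p m l L k K) {s : ℝ} (hs : 0 < s) {lam : ℝ}
    {w : ℝ → ℝ} (hw : IsEigenpair σ μ lam w) :
    w 0 ≠ 0 ∧ Real.sin (angle p m s lam 1) = 0 ∧ ∃ u q, EqOn w u (Icc 0 1) ∧
      IsSolution p m lam u q ∧ ∀ x ∈ Icc (0 : ℝ) 1,
        u x = w 0 * (amplitude p m s lam x * Real.cos (angle p m s lam x)) ∧
        q x = w 0 * (-(amplitude p m s lam x * Real.sin (angle p m s lam x)) * s) := by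
  obtain ⟨u, q, ew, hu⟩ := h.exists_isSolution hw
  have key : ∀ x ∈ Icc (0 : ℝ) 1,
      u x = w 0 * (amplitude p m s lam x * Real.cos (angle p m s lam x)) ∧
        q x = w 0 * (-(amplitude p m s lam x * Real.sin (angle p m s lam x)) * s) := by
    intro x hx
    have := (h.isPrueferAngle s lam).eq_of_system (u := u) (z := fun x => q x / s)
      (h.continuous_fluxCoeff s) (continuous_massCoeff h.continuous_m s lam) (fun x hx => ?_)
      (fun x hx => ?_) (by simp [hu.zero]) hx
    · rw [← ew (x := 0) (by simp)] at this
      refine ⟨this.1, ?_⟩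
      rw [← mul_assoc, ← div_eq_iff hs.ne']
      exact this.2
    · exact (hu.hasDerivAt_u x hx).congr_deriv (by rw [fluxCoeff]; field_simp)
    · exact ((hu.hasDerivAt_q x hx).div_const s).congr_deriv (by rw [massCoeff]; ring)
  have h0 : w 0 ≠ 0 := by
    intro h0
    obtain ⟨x, hx, hne⟩ := hw.ne_zero
    rw [ew hx, (key x hx).1, h0, zero_mul] at hne
    exact hne rfl
  refine ⟨h0, ?_, u, q, ew, hu, key⟩
  have := (key 1 (by simp)).2
  rw [hu.one] at this
  simpa [h0, hs.ne', (amplitude_pos p m s lam 1).ne'] using this.symm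

theorem exists_isEigenpair (h : IsExtension σ μ p m l L k K) {s : ℝ} (hs : 0 < s) {lam : ℝ}
    (h1 : Real.sin (angle p m s lam 1) = 0) : ∃ u, IsEigenpair σ μ lam u := by
  have hθ := h.isPrueferAngle s lam
  refine ⟨fun x => amplitude p m s lam x * Real.cos (angle p m s lam x), h.isEigenpair
    (q := fun x => -(amplitude p m s lam x * Real.sin (angle p m s lam x)) * s)
    ⟨fun x hx => ?_, fun x hx => ?_, by simp [hθ.zero], by simp [h1]⟩
    (by simp [hθ.zero, amplitude_zero])⟩
  · exact (hθ.cos_hasDerivAt (h.continuous_fluxCoeff s)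
      (continuous_massCoeff h.continuous_m s lam) hx).congr_deriv (by
        simp only [fluxCoeff, amplitude]; ring)
  · exact ((hθ.sin_hasDerivAt (h.continuous_fluxCoeff s)
      (continuous_massCoeff h.continuous_m s lam) hx).mul_const s).congr_deriv (by
        simp only [massCoeff, amplitude]; field_simp)

theorem continuousOn_density (h : IsExtension σ μ p m l L k K) : ContinuousOn μ (Icc 0 1) :=
  h.continuous_m.continuousOn.congr fun x hx => (h.m_eq x hx).symm

/-- Integrating a vanishing combination against `u i * μ` isolates the coefficient `g i`, by
orthogonality. -/
theorem linearIndependent_of_injective (h : IsExtension σ μ p m l L k K) {ι : Type*} [Fintype ι]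
    {t : ι → ℝ} (ht : Function.Injective t) {u : ι → ℝ → ℝ}
    (hu : ∀ i, IsEigenpair σ μ (t i) (u i)) :
    LinearIndependent ℝ fun i => (Icc (0 : ℝ) 1).domRestrict (u i) := by
  classical
  rw [Fintype.linearIndependent_iff]
  intro g hg i
  have hx : ∀ x ∈ Icc (0 : ℝ) 1, ∑ j, g j * u j x = 0 := fun x hx => by
    have := congrFun hg ⟨x, hx⟩
    simpa using this
  have hint : ∀ j, Integrable (fun x => g j * (u j x * u i x * μ x)) vol01 := fun j =>
    (integrable_vol01_of_continuousOn
      (((hu j).continuousOn.mul (hu i).continuousOn).mul h.continuousOn_density)).const_mul _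
  have e : ∑ j, g j * ∫ x, u j x * u i x * μ x ∂vol01 = 0 := by
    simp only [← integral_const_mul]
    rw [← integral_finsetSum _ fun j _ => hint j]
    refine integral_eq_zero_of_ae (ae_vol01_mem.mono fun x hx' => ?_)
    have : ∑ j, g j * (u j x * u i x * μ x) = (∑ j, g j * u j x) * (u i x * μ x) := by
      rw [Finset.sum_mul]
      exact Finset.sum_congr rfl fun j _ => by ring
    exact this.trans (by rw [hx x hx', zero_mul]; rfl)
  rw [Finset.sum_eq_single i (fun j _ hj => by
    rw [(hu j).integral_mul_eq_zero (hu i) fun h' => hj (ht h'), mul_zero]) (by simp)] at e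
  exact (mul_eq_zero.1 e).resolve_right
    (h.integral_sq_pos (hu i).continuousOn (hu i).ne_zero).ne'

/-- The `n`-th eigenvalue is characterised by the Prüfer angle `n π` at the right end point. -/
theorem isNthEigenvalue (h : IsExtension σ μ p m l L k K) {s : ℝ} (hs : 0 < s) {n : ℕ} {lam : ℝ}
    (h0 : 0 ≤ lam) (hn : angle p m s lam 1 = n * Real.pi) : IsNthEigenvalue σ μ n lam := by
  -- The angles `0, π, …, nπ` are all attained on `[0, lam]`; they provide the `n + 1`
  -- eigenfunctions.
  have hex : ∀ i : Fin (n + 1), ∃ t ∈ Icc 0 lam, angle p m s t 1 = (i : ℕ) * Real.pi := fun i =>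
    h.exists_angle_eq hs h0 (by positivity) (by
      rw [hn]
      have : ((i : ℕ) : ℝ) ≤ n := by exact_mod_cast Nat.lt_succ_iff.1 i.2
      gcongr)
  choose t ht hti using hex
  have hinj : Function.Injective t := by
    intro i j hij
    have e := hti i
    rw [hij, hti j] at e
    have := mul_right_cancel₀ Real.pi_ne_zero e
    exact Fin.ext (by exact_mod_cast this.symm)
  have heig : ∀ i, ∃ u, IsEigenpair σ μ (t i) u := fun i =>
    h.exists_isEigenpair hs (by rw [hti i, Real.sin_nat_mul_pi])
  choose u hu using heig
  refine ⟨⟨t, u, fun i => ⟨(ht i).2, hu i⟩, h.linearIndependent_of_injective hinj hu⟩, ?_⟩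
  rintro t' ⟨r, v, hrv, hli⟩
  by_contra! hlt
  -- An eigenvalue below `lam` has its angle among the `n` values `0, π, …, (n - 1)π`, so two of the
  -- `n + 1` eigenfunctions share it and hence share the eigenvalue.
  have hidx : ∀ i, ∃ j : Fin n, angle p m s (r i) 1 = (j : ℕ) * Real.pi := by
    intro i
    have hr0 := h.eigenvalue_nonneg (hrv i).2
    obtain ⟨N, hN⟩ := Real.sin_eq_zero_iff.1 (h.exists_pruefer_form hs (hrv i).2).2.1
    have h1 : 0 ≤ angle p m s (r i) 1 := by
      rw [← h.angle_zero s]; exact (h.angle_strictMono hs).monotone hr0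
    have h2 : angle p m s (r i) 1 < n * Real.pi := by
      rw [← hn]; exact h.angle_strictMono hs ((hrv i).1.trans_lt hlt)
    rw [← hN] at h1 h2
    have h3 : (0 : ℝ) ≤ N := nonneg_of_mul_nonneg_left h1 Real.pi_pos
    have h4 : (N : ℝ) < n := lt_of_mul_lt_mul_right h2 Real.pi_pos.le
    have h3' : 0 ≤ N := by exact_mod_cast h3
    lift N to ℕ using h3'
    exact ⟨⟨N, by exact_mod_cast h4⟩, by rw [← hN]; simp⟩
  choose f hf using hidx
  obtain ⟨i, j, hij, hfij⟩ := Fintype.exists_ne_map_eq_of_card_lt f (by simp)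
  have hr : r i = r j := (h.angle_strictMono hs).injective (by
    rw [hf i, hf j, hfij])
  obtain ⟨_, -, ui, _, ei, -, ki⟩ := h.exists_pruefer_form hs (hrv i).2
  obtain ⟨wj, -, uj, _, ej, -, kj⟩ := h.exists_pruefer_form hs (hrv j).2
  -- For equal eigenvalues both functions are multiples of the same polar solution, by their nonzero
  -- values at `0`; the cross combination of these values is a dependence.
  have hpair := (LinearIndepOn.pair_iff _ hij).1 (hli.linearIndepOn _) (v j 0) (-v i 0) (by
    ext ⟨x, hx⟩
    simp only [Pi.add_apply, Pi.smul_apply, domRestrict_apply, smul_eq_mul, Pi.zero_apply]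
    rw [ei hx, ej hx, (ki x hx).1, (kj x hx).1, hr]
    ring)
  exact wj hpair.1

end IsExtension

/-! ### Bounds for the coefficients in `MemTheta` -/

variable {d D : ℝ} {α : ℝ≥0}

instance : IsProbabilityMeasure vol01 := ⟨by simp [vol01]⟩

theorem supNorm_le_iff {f : ℝ → ℝ} {C : ℝ} (hC : 0 ≤ C) :
    supNorm f ≤ ENNReal.ofReal C ↔ ∀ x ∈ Icc (0 : ℝ) 1, |f x| ≤ C := by
  simp only [supNorm, iSup_le_iff, Real.enorm_eq_ofReal_abs, ENNReal.ofReal_le_ofReal_iff hC]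

theorem holderSeminorm_le {f : ℝ → ℝ} {C : ℝ} {β : ℝ≥0}
    (h : ∀ x ∈ Icc (0 : ℝ) 1, ∀ y ∈ Icc (0 : ℝ) 1, |f x - f y| ≤ C * |x - y| ^ (β : ℝ)) :
    holderSeminorm β f ≤ ENNReal.ofReal C := by
  refine HolderWith.eHolderNorm_le fun x y => ?_
  have e : ((C.toNNReal : ℝ≥0) : ℝ≥0∞) = ENNReal.ofReal C := rfl
  rw [edist_dist, edist_dist, ENNReal.ofReal_rpow_of_nonneg dist_nonneg β.coe_nonneg, e,
    ← ENNReal.ofReal_mul' (Real.rpow_nonneg dist_nonneg _)]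
  exact ENNReal.ofReal_le_ofReal (h x x.2 y y.2)

theorem abs_sub_le_of_holderSeminorm_le {f : ℝ → ℝ} {C : ℝ} {β : ℝ≥0} (hC : 0 ≤ C)
    (h : holderSeminorm β f ≤ ENNReal.ofReal C) {x y : ℝ} (hx : x ∈ Icc (0 : ℝ) 1)
    (hy : y ∈ Icc (0 : ℝ) 1) : |f x - f y| ≤ C * |x - y| ^ (β : ℝ) := by
  have hm : MemHolder β ((Icc (0 : ℝ) 1).domRestrict f) :=
    eHolderNorm_lt_top.1 (h.trans_lt ENNReal.ofReal_lt_top)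
  have h1 := hm.holderWith.dist_le ⟨x, hx⟩ ⟨y, hy⟩
  have h2 : (nnHolderNorm β ((Icc (0 : ℝ) 1).domRestrict f) : ℝ) ≤ C := by
    have := coe_nnHolderNorm_le_eHolderNorm.trans h
    rw [ENNReal.ofReal, ENNReal.coe_le_coe] at this
    exact (NNReal.coe_le_coe.2 this).trans (Real.coe_toNNReal C hC).le
  exact h1.trans (mul_le_mul_of_nonneg_right h2 (by positivity))

/-- Cauchy–Schwarz on `[x, y]`; it gives the embedding of `H¹` into the Hölder space of exponent
`1/2`. -/
theorem abs_integral_le_of_eLpNorm_le {g : ℝ → ℝ} (hg : MemLp g 2 vol01) {C : ℝ} (hC : 0 ≤ C)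
    (h : eLpNorm g 2 vol01 ≤ ENNReal.ofReal C) {x y : ℝ} (hx : 0 ≤ x) (hxy : x ≤ y) (hy : y ≤ 1) :
    |∫ t in x..y, g t| ≤ C * (y - x) ^ (1 / 2 : ℝ) := by
  rw [intervalIntegral.integral_of_le hxy]
  have hle : volume.restrict (Ioc x y) ≤ vol01 :=
    Measure.restrict_mono (fun t (ht : t ∈ Ioc x y) =>
      (⟨hx.trans ht.1.le, ht.2.trans hy⟩ : t ∈ Icc (0 : ℝ) 1)) le_rfl
  have hsm := hg.1.mono_measure hle
  rw [← ENNReal.ofReal_le_ofReal_iff (mul_nonneg hC (Real.rpow_nonneg (sub_nonneg.2 hxy) _)),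
    ← Real.enorm_eq_ofReal_abs]
  calc ‖∫ t in Ioc x y, g t‖ₑ ≤ ∫⁻ t in Ioc x y, ‖g t‖ₑ := enorm_integral_le_lintegral_enorm _
    _ = eLpNorm g 1 (volume.restrict (Ioc x y)) := eLpNorm_one_eq_lintegral_enorm.symm
    _ ≤ eLpNorm g 2 (volume.restrict (Ioc x y)) *
          (volume.restrict (Ioc x y)) univ ^ (1 / (1 : ℝ≥0∞).toReal - 1 / (2 : ℝ≥0∞).toReal) :=
        eLpNorm_le_eLpNorm_mul_rpow_measure_univ (by norm_num) hsm
    _ ≤ ENNReal.ofReal C * ENNReal.ofReal (y - x) ^ (1 / 2 : ℝ) := by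
        refine mul_le_mul' ((eLpNorm_mono_measure g hle).trans h) (le_of_eq ?_)
        rw [Measure.restrict_apply_univ, Real.volume_Ioc]
        norm_num
    _ = ENNReal.ofReal (C * (y - x) ^ (1 / 2 : ℝ)) := by
        rw [ENNReal.ofReal_rpow_of_nonneg (sub_nonneg.2 hxy) (by norm_num), ENNReal.ofReal_mul hC]

namespace MemTheta

theorem density_le (h : MemTheta α d D σ μ) (hD : 0 ≤ D) {x : ℝ} (hx : x ∈ Icc (0 : ℝ) 1) :
    |μ x| ≤ D :=
  (supNorm_le_iff hD).1 (le_self_add.trans h.holderNorm_le) x hx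

theorem density_holder (h : MemTheta α d D σ μ) (hD : 0 ≤ D) {x y : ℝ} (hx : x ∈ Icc (0 : ℝ) 1)
    (hy : y ∈ Icc (0 : ℝ) 1) : |μ x - μ y| ≤ D * |x - y| ^ (α : ℝ) :=
  abs_sub_le_of_holderSeminorm_le hD (le_add_self.trans h.holderNorm_le) hx hy

theorem density_continuousOn (h : MemTheta α d D σ μ) (hα : 0 < α) :
    ContinuousOn μ (Icc 0 1) := by
  have hm : MemHolder α ((Icc (0 : ℝ) 1).domRestrict μ) :=
    eHolderNorm_lt_top.1 ((le_add_self.trans h.holderNorm_le).trans_lt ENNReal.ofReal_lt_top)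
  exact continuousOn_iff_continuous_domRestrict.2 (hm.holderWith.continuous hα)

theorem dispersion_holder (h : MemTheta α d D σ μ) (hD : 0 ≤ D) {x y : ℝ}
    (hx : x ∈ Icc (0 : ℝ) 1) (hy : y ∈ Icc (0 : ℝ) 1) :
    |σ x - σ y| ≤ D * |x - y| ^ (1 / 2 : ℝ) := by
  wlog hxy : x ≤ y generalizing x y
  · rw [abs_sub_comm, abs_sub_comm x]
    exact this hy hx (le_of_not_ge hxy)
  have hw := h.memH1.weakDeriv_spec.1
  have e := h.memH1.eqOn_primitive h.continuousOn
  rw [abs_sub_comm, abs_sub_comm x, abs_of_nonneg (sub_nonneg.2 hxy), e hx, e hy,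
    primitive_sub (integrable_of_memLp hw) _ hx hy]
  exact abs_integral_le_of_eLpNorm_le hw hD (le_add_self.trans h.h1Norm_le) hx.1 hxy hy.2

/-- Averaging `|σ x| ≤ |σ y| + D` over `y`: one `D` bounds the oscillation, the other bounds the
`L¹` norm through the `L²` norm. -/
theorem dispersion_le (h : MemTheta α d D σ μ) (hD : 0 ≤ D) {x : ℝ} (hx : x ∈ Icc (0 : ℝ) 1) :
    |σ x| ≤ 2 * D := by
  rw [← ENNReal.ofReal_le_ofReal_iff (by positivity), two_mul, ENNReal.ofReal_add hD hD]
  calc ENNReal.ofReal |σ x| = ∫⁻ _, ENNReal.ofReal |σ x| ∂vol01 := by simp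
    _ ≤ ∫⁻ y, (‖σ y‖ₑ + ENNReal.ofReal D) ∂vol01 := by
        refine lintegral_mono_ae (ae_vol01_mem.mono fun y hy => ?_)
        rw [Real.enorm_eq_ofReal_abs, ← ENNReal.ofReal_add (abs_nonneg _) hD]
        refine ENNReal.ofReal_le_ofReal ?_
        have h1 := h.dispersion_holder hD hx hy
        have h2 : |x - y| ^ (1 / 2 : ℝ) ≤ 1 := Real.rpow_le_one (abs_nonneg _)
          (abs_le.2 ⟨by linarith [hx.1, hy.2], by linarith [hx.2, hy.1]⟩) (by norm_num)
        have h3 := abs_sub_abs_le_abs_sub (σ x) (σ y)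
        nlinarith
    _ = eLpNorm σ 1 vol01 + ENNReal.ofReal D := by
        rw [lintegral_add_right _ measurable_const, eLpNorm_one_eq_lintegral_enorm]; simp
    _ ≤ _ := by
        gcongr
        exact (eLpNorm_le_eLpNorm_of_exponent_le (by norm_num) h.memH1.1.1).trans
          (le_self_add.trans h.h1Norm_le)

/-- Extension is by the boundary values. The constants come from `d ≤ σ ≤ 2D` and `d ≤ μ ≤ D`. -/
theorem exists_isExtension (h : MemTheta α d D σ μ) (hα : 0 < α) (hd : 0 < d) (hD : 0 ≤ D) :
    ∃ p m, IsExtension σ μ p m (d ^ 3) (4 * D ^ 3) d D ∧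
      ∀ x ∈ Icc (0 : ℝ) 1, ∀ y ∈ Icc (0 : ℝ) 1,
        |p x - p y| ≤ 8 * D ^ 3 * |x - y| ^ ((min (1 / 2) α : ℝ≥0) : ℝ) := by
  have cμ := h.density_continuousOn hα
  have cp : ContinuousOn (fun x => σ x ^ 2 * μ x) (Icc 0 1) := (h.continuousOn.pow 2).mul cμ
  have em : ∀ {f : ℝ → ℝ}, ∀ x ∈ Icc (0 : ℝ) 1,
      IccExtend zero_le_one ((Icc (0 : ℝ) 1).domRestrict f) x = f x := fun x hx => by
    rw [IccExtend_of_mem _ _ hx]; rfl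
  have hlo : ∀ x ∈ Icc (0 : ℝ) 1, d ≤ σ x ∧ d ≤ μ x := fun x hx => le_min_iff.1 (h.le_inf x hx)
  have hσ : ∀ x ∈ Icc (0 : ℝ) 1, σ x ≤ 2 * D := fun x hx =>
    (le_abs_self _).trans (h.dispersion_le hD hx)
  have hμ : ∀ x ∈ Icc (0 : ℝ) 1, μ x ≤ D := fun x hx =>
    (le_abs_self _).trans (h.density_le hD hx)
  refine ⟨IccExtend zero_le_one ((Icc (0 : ℝ) 1).domRestrict fun x => σ x ^ 2 * μ x),
    IccExtend zero_le_one ((Icc (0 : ℝ) 1).domRestrict μ), ⟨cp.domRestrict.Icc_extend',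
    cμ.domRestrict.Icc_extend', by positivity, hd, fun x => ?_, fun x => ?_, fun x => ?_,
    fun x => ?_, em, em⟩, fun x hx y hy => ?_⟩
  · have hx := (projIcc (0 : ℝ) 1 zero_le_one x).2
    have := hlo _ hx
    calc d ^ 3 = d ^ 2 * d := by ring
      _ ≤ _ := mul_le_mul (pow_le_pow_left₀ hd.le this.1 2) this.2 hd.le (sq_nonneg _)
  · have hx := (projIcc (0 : ℝ) 1 zero_le_one x).2
    have := hlo _ hx
    calc _ ≤ (2 * D) ^ 2 * D := mul_le_mul
          (pow_le_pow_left₀ (hd.le.trans this.1) (hσ _ hx) 2) (hμ _ hx) (hd.le.trans this.2)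
          (sq_nonneg _)
      _ = 4 * D ^ 3 := by ring
  · exact (hlo _ (projIcc (0 : ℝ) 1 zero_le_one x).2).2
  · exact hμ _ (projIcc (0 : ℝ) 1 zero_le_one x).2
  · rw [em x hx, em y hy]
    set γ : ℝ := ((min (1 / 2) α : ℝ≥0) : ℝ) with hγ
    set t := |x - y| with ht
    have t1 : t ≤ 1 := abs_le.2 ⟨by linarith [hx.1, hy.2], by linarith [hx.2, hy.1]⟩
    have γ0 : 0 < γ := by rw [hγ]; exact_mod_cast lt_min (by norm_num) hα
    -- Distances in `[0,1]` are at most `1`, so both Hölder bounds may be weakened to the common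
    -- exponent `γ`.
    have pw : ∀ β : ℝ, γ ≤ β → t ^ β ≤ t ^ γ := fun β hβ => by
      rcases eq_or_lt_of_le (abs_nonneg (x - y)) with h0 | h0
      · rw [← ht] at h0
        rw [← h0, Real.zero_rpow γ0.ne', Real.zero_rpow (γ0.trans_le hβ).ne']
      · exact Real.rpow_le_rpow_of_exponent_ge h0 t1 hβ
    have g1 : γ ≤ 1 / 2 := by
      have : min (1 / 2) α ≤ (1 / 2 : ℝ≥0) := min_le_left _ _
      have := NNReal.coe_le_coe.2 this
      rw [hγ]; exact this.trans (by simp)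
    have g2 : γ ≤ α := by rw [hγ]; exact_mod_cast min_le_right _ _
    have s1 := (h.dispersion_holder hD hx hy).trans (mul_le_mul_of_nonneg_left (pw _ g1) hD)
    have s2 := (h.density_holder hD hx hy).trans (mul_le_mul_of_nonneg_left (pw _ g2) hD)
    have b1 : |σ x + σ y| ≤ 4 * D := (abs_add_le _ _).trans
      (by linarith [h.dispersion_le hD hx, h.dispersion_le hD hy])
    have b2 := h.density_le hD hx
    have b3 : |σ y ^ 2| ≤ (2 * D) ^ 2 := by
      rw [abs_pow]; exact pow_le_pow_left₀ (abs_nonneg _) (h.dispersion_le hD hy) 2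
    have tn : 0 ≤ t ^ γ := Real.rpow_nonneg (abs_nonneg _) _
    calc |σ x ^ 2 * μ x - σ y ^ 2 * μ y|
        = |(σ x - σ y) * (σ x + σ y) * μ x + σ y ^ 2 * (μ x - μ y)| := by congr 1; ring
      _ ≤ |σ x - σ y| * |σ x + σ y| * |μ x| + |σ y ^ 2| * |μ x - μ y| := by
          rw [← abs_mul, ← abs_mul, ← abs_mul]; exact abs_add_le _ _
      _ ≤ D * t ^ γ * (4 * D) * D + (2 * D) ^ 2 * (D * t ^ γ) := by gcongr
      _ = 8 * D ^ 3 * t ^ γ := by ring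

end MemTheta

/-! ### Quantitative bounds for eigenvalues and eigenfunctions -/

theorem sin_le_sin_of_mem {η x : ℝ} (h0 : 0 ≤ η) (h1 : η ≤ Real.pi / 2) (hx : η ≤ x)
    (hx' : x ≤ Real.pi - η) : Real.sin η ≤ Real.sin x := by
  rcases le_total x (Real.pi / 2) with h | h
  · exact Real.sin_le_sin_of_le_of_le_pi_div_two (by linarith) h hx
  · rw [← Real.sin_pi_sub x]
    exact Real.sin_le_sin_of_le_of_le_pi_div_two (by linarith) (by linarith) (by linarith)

theorem abs_sub_le_of_hasDerivAt {f f' : ℝ → ℝ} {C : ℝ}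
    (hf : ∀ x ∈ Icc (0 : ℝ) 1, HasDerivAt f (f' x) x) (hC : ∀ x ∈ Icc (0 : ℝ) 1, |f' x| ≤ C)
    {x y : ℝ} (hx : x ∈ Icc (0 : ℝ) 1) (hy : y ∈ Icc (0 : ℝ) 1) : |f x - f y| ≤ C * |x - y| :=
  (convex_Icc (0 : ℝ) 1).norm_image_sub_le_of_norm_hasDerivWithin_le
    (fun z hz => (hf z hz).hasDerivWithinAt) hC hy hx

namespace IsExtension

/-- `s` makes the flux coefficient at least `2π` and `Λ` does the same for the mass coefficient, so
the angle gains at least `2π` over the unit interval. -/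
theorem pi_le_angle (h : IsExtension σ μ p m l L k K) {s Λ : ℝ} (hs : s = 2 * Real.pi * L)
    (hΛ : Λ = Real.pi * s / k) : 2 * Real.pi ≤ angle p m s Λ 1 := by
  have hk := h.k_pos
  have hL : 0 < L := (h.p_pos 0).trans_le (h.p_le 0)
  have hpi := Real.pi_pos
  have hθ := h.isPrueferAngle s Λ
  have := hθ.mul_sub_le (k := 2 * Real.pi) (fun x _ => ?_) (fun x _ => ?_) le_rfl zero_le_one le_rfl
  · rw [hθ.zero] at this; linarith
  · rw [fluxCoeff, le_div_iff₀ (h.p_pos x), hs]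
    exact mul_le_mul_of_nonneg_left (h.p_le x) (by positivity)
  · have hs0 : 0 < s := by rw [hs]; positivity
    rw [massCoeff, le_div_iff₀ hs0, hΛ]
    have := h.le_m x
    calc 2 * Real.pi * s = 2 * (Real.pi * s / k) * k := by field_simp
      _ ≤ _ := by gcongr

/-- Quantitative description of an eigenfunction `w` through its flux `q = p w'`. -/
theorem exists_flux (h : IsExtension σ μ p m l L k K) {s Λ κ lam : ℝ} (hs : 0 < s)
    (hκ : κ = s / l + 2 * Λ * K / s) (hlam : lam ≤ Λ) {w : ℝ → ℝ} (hw : IsEigenpair σ μ lam w) :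
    ∃ q : ℝ → ℝ,
      (∀ x ∈ Icc (0 : ℝ) 1, HasDerivWithinAt w (q x / p x) (Icc 0 1) x) ∧
      (∀ x ∈ Icc (0 : ℝ) 1, |w x| ≤ |w 0| * Real.exp κ) ∧
      (∀ x ∈ Icc (0 : ℝ) 1, |q x| ≤ |w 0| * Real.exp κ * s) ∧
      (∀ x ∈ Icc (0 : ℝ) 1, ∀ y ∈ Icc (0 : ℝ) 1,
        |w x - w y| ≤ |w 0| * (Real.exp κ * s / l) * |x - y|) ∧
      (∀ x ∈ Icc (0 : ℝ) 1, ∀ y ∈ Icc (0 : ℝ) 1,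
        |q x - q y| ≤ |w 0| * (2 * Λ * K * Real.exp κ) * |x - y|) ∧
      ∀ x ∈ Icc (0 : ℝ) 1, |w 0| * Real.exp (-κ) * s * |Real.sin (angle p m s lam x)| ≤ |q x| := by
  have h0 := h.eigenvalue_nonneg hw
  obtain ⟨-, -, u, q, ew, hu, key⟩ := h.exists_pruefer_form hs hw
  have amp : ∀ x ∈ Icc (0 : ℝ) 1, |IsPrueferAngle.logAmplitude (fluxCoeff p s)
      (massCoeff m s lam) (angle p m s lam) x| ≤ κ := fun x hx =>
    IsPrueferAngle.abs_logAmplitude_le (fun t _ => hκ ▸ h.abs_coeff_sub_le hs h0 hlam t) hx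
  have amp1 : ∀ x ∈ Icc (0 : ℝ) 1, amplitude p m s lam x ≤ Real.exp κ := fun x hx =>
    Real.exp_le_exp.2 ((le_abs_self _).trans (amp x hx))
  have amp2 : ∀ x ∈ Icc (0 : ℝ) 1, Real.exp (-κ) ≤ amplitude p m s lam x := fun x hx =>
    Real.exp_le_exp.2 (neg_le_of_abs_le (amp x hx))
  have bu : ∀ x ∈ Icc (0 : ℝ) 1, |u x| ≤ |w 0| * Real.exp κ := fun x hx => by
    rw [(key x hx).1, abs_mul, abs_mul, abs_of_pos (amplitude_pos _ _ _ _ _)]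
    gcongr
    exact (mul_le_of_le_one_right (amplitude_pos _ _ _ _ _).le (Real.abs_cos_le_one _)).trans
      (amp1 x hx)
  have eq : ∀ x ∈ Icc (0 : ℝ) 1, |q x| =
      |w 0| * (amplitude p m s lam x * |Real.sin (angle p m s lam x)| * s) := fun x hx => by
    rw [(key x hx).2, abs_mul, abs_mul, abs_neg, abs_mul, abs_of_pos (amplitude_pos _ _ _ _ _),
      abs_of_pos hs]
  have bq : ∀ x ∈ Icc (0 : ℝ) 1, |q x| ≤ |w 0| * Real.exp κ * s := fun x hx => by
    rw [eq x hx, mul_assoc |w 0|]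
    gcongr
    exact (mul_le_of_le_one_right (amplitude_pos _ _ _ _ _).le (Real.abs_sin_le_one _)).trans
      (amp1 x hx)
  refine ⟨q, fun x hx => ?_, fun x hx => ew hx ▸ bu x hx, bq, fun x hx y hy => ?_,
    fun x hx y hy => ?_, fun x hx => ?_⟩
  · exact (hu.hasDerivAt_u x hx).hasDerivWithinAt.congr (fun y hy => ew hy) (ew hx)
  · rw [ew hx, ew hy]
    refine abs_sub_le_of_hasDerivAt hu.hasDerivAt_u (fun t ht => ?_) hx hy
    have hl := h.l_pos
    rw [abs_div, abs_of_pos (h.p_pos t), ← mul_div_assoc, ← mul_assoc]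
    exact div_le_div₀ (by positivity) (bq t ht) hl (h.le_p t)
  · refine abs_sub_le_of_hasDerivAt hu.hasDerivAt_q (fun t ht => ?_) hx hy
    have hm := h.m_pos t
    have hm' := h.m_le t
    have hK : 0 < K := hm.trans_le hm'
    have hΛ : 0 ≤ Λ := h0.trans hlam
    rw [abs_neg, abs_mul, abs_of_nonneg (by positivity : 0 ≤ 2 * lam * m t)]
    calc 2 * lam * m t * |u t| ≤ 2 * Λ * K * (|w 0| * Real.exp κ) := by
          have := bu t ht
          gcongr
      _ = _ := by ring
  · rw [eq x hx]
    have := amp2 x hx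
    calc _ = |w 0| * (Real.exp (-κ) * |Real.sin (angle p m s lam x)| * s) := by ring
      _ ≤ _ := by gcongr

theorem l2Norm_eq (h : IsExtension σ μ p m l L k K) (w : ℝ → ℝ) :
    l2Norm μ w = Real.sqrt (∫ x in (0 : ℝ)..1, w x ^ 2 * m x) := by
  rw [l2Norm, ← integral_vol01]
  congr 1
  exact integral_congr_ae (ae_vol01_mem.mono fun x hx => by simp only [h.m_eq x hx])

theorem l2Norm_le (h : IsExtension σ μ p m l L k K) {w : ℝ → ℝ} {C : ℝ} (hC : 0 ≤ C)
    (hb : ∀ x ∈ Icc (0 : ℝ) 1, |w x| ≤ C) :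
    l2Norm μ w ≤ C * Real.sqrt K := by
  have hK : 0 < K := (h.m_pos 0).trans_le (h.m_le 0)
  rw [h.l2Norm_eq, ← Real.sqrt_sq hC, ← Real.sqrt_mul (sq_nonneg _)]
  refine Real.sqrt_le_sqrt ((le_abs_self _).trans ?_)
  have := intervalIntegral.norm_integral_le_of_norm_le_const (f := fun x => w x ^ 2 * m x)
    (a := 0) (b := 1) (C := C ^ 2 * K) (fun t ht => by
      rw [uIoc_of_le zero_le_one] at ht
      rw [norm_mul, norm_pow, Real.norm_eq_abs, Real.norm_eq_abs, abs_of_pos (h.m_pos t)]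
      have := hb t (Ioc_subset_Icc_self ht)
      have := h.m_le t
      have := h.m_pos t
      gcongr)
  simpa using this

/-- The Lipschitz bound keeps `|w| ≥ |w 0| / 2` on an initial interval of length `1 / (1 + 2 * B)`;
that part of the integral alone suffices. -/
theorem le_l2Norm (h : IsExtension σ μ p m l L k K) {w : ℝ → ℝ} (hw : ContinuousOn w (Icc 0 1))
    {B : ℝ} (hB : 0 < B)
    (hb : ∀ x ∈ Icc (0 : ℝ) 1, ∀ y ∈ Icc (0 : ℝ) 1, |w x - w y| ≤ |w 0| * B * |x - y|) :
    |w 0| * Real.sqrt (k / (4 * (1 + 2 * B))) ≤ l2Norm μ w := by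
  have hk := h.k_pos
  rw [h.l2Norm_eq, ← Real.sqrt_sq (abs_nonneg (w 0)), ← Real.sqrt_mul (sq_nonneg _)]
  refine Real.sqrt_le_sqrt ?_
  set ε := 1 / (1 + 2 * B) with hε
  have ε0 : 0 < ε := by positivity
  have ε1 : ε ≤ 1 := by rw [hε, div_le_one (by positivity)]; linarith
  have εB : B * ε ≤ 1 / 2 := by rw [hε, mul_one_div, div_le_iff₀ (by positivity)]; linarith
  have hc : ContinuousOn (fun x => w x ^ 2 * m x) (Icc 0 1) :=
    (hw.pow 2).mul h.continuous_m.continuousOn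
  have h1 : ∫ x in (0 : ℝ)..ε, |w 0| ^ 2 / 4 * k ≤ ∫ x in (0 : ℝ)..ε, w x ^ 2 * m x := by
    refine intervalIntegral.integral_mono_on ε0.le (by simp) ?_ fun x hx => ?_
    · refine (hc.mono ?_).intervalIntegrable
      rw [uIcc_of_le ε0.le]; exact Icc_subset_Icc_right ε1
    · have := hb x ⟨hx.1, hx.2.trans ε1⟩ 0 (by simp)
      rw [sub_zero, abs_of_nonneg hx.1] at this
      have h2 : |w 0| * B * x ≤ |w 0| / 2 := by
        calc |w 0| * B * x ≤ |w 0| * B * ε := by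
              have := hx.2
              gcongr
          _ = |w 0| * (B * ε) := by ring
          _ ≤ |w 0| * (1 / 2) := by gcongr
          _ = _ := by ring
      have h3 := abs_sub_abs_le_abs_sub (w 0) (w x)
      rw [abs_sub_comm] at h3
      have h4 : |w 0| / 2 ≤ |w x| := by linarith
      have h5 : |w 0| ^ 2 / 4 ≤ w x ^ 2 := by
        rw [← sq_abs (w x)]
        calc |w 0| ^ 2 / 4 = (|w 0| / 2) ^ 2 := by ring
          _ ≤ _ := by gcongr
      exact mul_le_mul h5 (h.le_m x) hk.le (sq_nonneg _)
  have h2 : ∫ x in (0 : ℝ)..ε, w x ^ 2 * m x ≤ ∫ x in (0 : ℝ)..1, w x ^ 2 * m x := by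
    refine intervalIntegral.integral_mono_interval le_rfl ε0.le ε1
      (Filter.Eventually.of_forall fun x => mul_nonneg (sq_nonneg _) (h.m_pos x).le) ?_
    refine ContinuousOn.intervalIntegrable ?_
    rwa [uIcc_of_le zero_le_one]
  refine le_trans (le_of_eq ?_) (h1.trans h2)
  rw [intervalIntegral.integral_const, smul_eq_mul, sub_zero, hε]
  field_simp

/-- The lower bound on the gap between eigenvalues with Prüfer angles `π` apart. -/
theorem gap_le (h : IsExtension σ μ p m l L k K) {s Λ κ lam lam' : ℝ} (hs : 0 < s)
    (hκ : κ = s / l + 2 * Λ * K / s) (h0 : 0 ≤ lam) (hl : lam ≤ lam') (hΛ : lam ≤ Λ)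
    (hπ : angle p m s lam' 1 - angle p m s lam 1 = Real.pi) :
    Real.pi / (2 * K / s * Real.exp (2 * κ)) ≤ lam' - lam := by
  have hK : 0 < K := (h.m_pos 0).trans_le (h.m_le 0)
  have := h.angle_sub_le hs h0 hl hΛ
  rw [hπ, ← hκ] at this
  rw [div_le_iff₀ (by positivity)]
  linarith

/-- The first two nontrivial eigenvalues. -/
theorem exists_eigenvalues (h : IsExtension σ μ p m l L k K) {s Λ κ : ℝ}
    (hs : s = 2 * Real.pi * L) (hΛ : Λ = Real.pi * s / k) (hκ : κ = s / l + 2 * Λ * K / s) :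
    ∃ lam₁ lam₂ : ℝ, IsNthEigenvalue σ μ 1 lam₁ ∧ IsNthEigenvalue σ μ 2 lam₂ ∧
      Real.pi / (2 * K / s * Real.exp (2 * κ)) ≤ lam₁ ∧ lam₁ ≤ Λ ∧ lam₂ ≤ Λ ∧
      Real.pi / (2 * K / s * Real.exp (2 * κ)) ≤ lam₂ - lam₁ ∧
      angle p m s lam₁ 1 = Real.pi := by
  have hpi := Real.pi_pos
  have hk := h.k_pos
  have hL : 0 < L := (h.p_pos 0).trans_le (h.p_le 0)
  have hs0 : 0 < s := by rw [hs]; positivity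
  have hΛ0 : 0 ≤ Λ := by rw [hΛ]; positivity
  have h2 := h.pi_le_angle hs hΛ
  obtain ⟨lam₁, h1, e1⟩ := h.exists_angle_eq hs0 hΛ0 hpi.le (by linarith)
  obtain ⟨lam₂, h2, e2⟩ := h.exists_angle_eq hs0 hΛ0 (by positivity) h2
  have h12 : lam₁ < lam₂ := (h.angle_strictMono hs0).lt_iff_lt.1 (by
    change angle p m s lam₁ 1 < angle p m s lam₂ 1
    linarith)
  refine ⟨lam₁, lam₂, h.isNthEigenvalue hs0 h1.1 (by simpa using e1),
    h.isNthEigenvalue hs0 h2.1 (by simpa using e2), ?_, h1.2, h2.2,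
    h.gap_le hs0 hκ h1.1 h12.le h1.2 (by linarith), e1⟩
  -- The lower bound for `lam₁` is the gap estimate applied to the eigenvalue `0`, whose angle is
  -- `0`.
  have := h.gap_le hs0 hκ le_rfl h1.1 hΛ0 (by rw [e1, h.angle_zero, sub_zero])
  rwa [sub_zero] at this

/-- The `C^{1,γ}` norm of an eigenfunction. -/
theorem c1HolderNorm_le (h : IsExtension σ μ p m l L k K) {s Λ κ lam P : ℝ} {γ : ℝ≥0}
    (hγ : γ ≤ 1) (hP : ∀ x ∈ Icc (0 : ℝ) 1, ∀ y ∈ Icc (0 : ℝ) 1,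
      |p x - p y| ≤ P * |x - y| ^ (γ : ℝ)) (hs : 0 < s)
    (hκ : κ = s / l + 2 * Λ * K / s) (hlam : lam ≤ Λ) {w : ℝ → ℝ} (hw : IsEigenpair σ μ lam w) :
    DifferentiableOn ℝ w (Icc 0 1) ∧ c1HolderNorm γ w ≤ ENNReal.ofReal (|w 0| *
      (Real.exp κ + (Real.exp κ * s / l +
        (2 * Λ * K * Real.exp κ / l + Real.exp κ * s * P / l ^ 2)))) := by
  obtain ⟨q, hd, bw, bq, -, lq, -⟩ := h.exists_flux hs hκ hlam hw
  have hl := h.l_pos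
  have hK : 0 < K := (h.m_pos 0).trans_le (h.m_le 0)
  have hΛ : 0 ≤ Λ := (h.eigenvalue_nonneg hw).trans hlam
  have hP0 : 0 ≤ P := by
    have := (abs_nonneg _).trans (hP 0 (by simp) 1 (by simp))
    simpa using this
  have ed : ∀ x ∈ Icc (0 : ℝ) 1, deriv01 w x = q x / p x := fun x hx =>
    (hd x hx).derivWithin (uniqueDiffOn_Icc zero_lt_one x hx)
  refine ⟨fun x hx => (hd x hx).differentiableWithinAt, ?_⟩
  rw [mul_add, ENNReal.ofReal_add (by positivity) (by positivity), mul_add,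
    ENNReal.ofReal_add (by positivity) (by positivity), c1HolderNorm, holderNorm]
  refine add_le_add ((supNorm_le_iff (by positivity)).2 bw)
    (add_le_add ((supNorm_le_iff (by positivity)).2 fun x hx => ?_)
      (holderSeminorm_le fun x hx y hy => ?_))
  · rw [ed x hx, abs_div, abs_of_pos (h.p_pos x), ← mul_div_assoc, ← mul_assoc]
    exact div_le_div₀ (by positivity) (bq x hx) hl (h.le_p x)
  · have hpx := h.p_pos x
    have hpy := h.p_pos y
    rw [ed x hx, ed y hy]
    have t1 : |x - y| ≤ 1 := abs_le.2 ⟨by linarith [hx.1, hy.2], by linarith [hx.2, hy.1]⟩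
    have tγ : |x - y| ≤ |x - y| ^ (γ : ℝ) := by
      rcases eq_or_lt_of_le (abs_nonneg (x - y)) with h0 | h0
      · rw [← h0]; exact Real.rpow_nonneg le_rfl _
      · conv_lhs => rw [← Real.rpow_one |x - y|]
        exact Real.rpow_le_rpow_of_exponent_ge h0 t1 (by exact_mod_cast hγ)
    -- The first term is Lipschitz like `q`; the second carries the Hölder modulus of `p`.
    have e : q x / p x - q y / p y = (q x - q y) / p x + q y * (p y - p x) / (p x * p y) := by
      field_simp; ring
    have b1 : |(q x - q y) / p x| ≤ |w 0| * (2 * Λ * K * Real.exp κ) * |x - y| ^ (γ : ℝ) / l := by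
      rw [abs_div, abs_of_pos hpx]
      refine div_le_div₀ (by positivity) ((lq x hx y hy).trans ?_) hl (h.le_p x)
      gcongr
    have b2 : |q y * (p y - p x) / (p x * p y)| ≤
        |w 0| * Real.exp κ * s * (P * |x - y| ^ (γ : ℝ)) / l ^ 2 := by
      rw [abs_div, abs_of_pos (mul_pos hpx hpy), abs_mul, abs_sub_comm (p y)]
      refine div_le_div₀ (by positivity)
        (mul_le_mul (bq y hy) (hP x hx y hy) (abs_nonneg _) (by positivity)) (by positivity) ?_
      rw [sq]
      exact mul_le_mul (h.le_p x) (h.le_p y) hl.le hpx.le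
    rw [e]
    refine (abs_add_le _ _).trans ((add_le_add b1 b2).trans (le_of_eq ?_))
    ring

/-- The lower bound on the derivative of a first eigenfunction inside the interval. -/
theorem le_abs_deriv (h : IsExtension σ μ p m l L k K) {s Λ κ lam c : ℝ} (hs : 0 < s)
    (hκ : κ = s / l + 2 * Λ * K / s) (hlam : lam ≤ Λ) (hc : 0 ≤ c) (hclam : c ≤ lam)
    (hπ : angle p m s lam 1 = Real.pi) {w : ℝ → ℝ} (hw : IsEigenpair σ μ lam w) {η a b x : ℝ}
    (hη : 0 ≤ η) (hη' : η ≤ Real.pi / 2) (ha : 0 ≤ a) (hb : b ≤ 1)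
    (hηa : η ≤ min (s / L) (2 * c * k / s) * a) (hηb : η ≤ min (s / L) (2 * c * k / s) * (1 - b))
    (hx : x ∈ Icc a b) :
    |w 0| * (Real.exp (-κ) * s * Real.sin η / L) ≤ |deriv01 w x| := by
  obtain ⟨q, hd, -, -, -, -, lq⟩ := h.exists_flux hs hκ hlam hw
  have hk := h.k_pos
  have hL : 0 < L := (h.p_pos 0).trans_le (h.p_le 0)
  have hx1 : x ∈ Icc (0 : ℝ) 1 := ⟨ha.trans hx.1, hx.2.trans hb⟩
  have hpx := h.p_pos x
  have hθ := h.isPrueferAngle s lam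
  set r := min (s / L) (2 * c * k / s) with hr
  have hr0 : 0 ≤ r := le_min (by positivity) (by positivity)
  have rate := fun {y z : ℝ} => hθ.mul_sub_le (k := r) (x := y) (y := z)
    (fun x _ => (min_le_left _ _).trans
      (div_le_div_of_nonneg_left hs.le (h.p_pos x) (h.p_le x)))
    (fun x _ => (min_le_right _ _).trans (by
      have := h.le_m x
      have := hc.trans hclam
      unfold massCoeff
      gcongr))
  -- Growth from `θ(0) = 0` gives `θ(x) ≥ r a ≥ η`; growth up to `θ(1) = π` gives `θ(x) ≤ π - r (1 -
  -- b) ≤ π - η`.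
  have h1 := rate le_rfl hx1.1 hx1.2
  have h2 := rate hx1.1 hx1.2 le_rfl
  rw [hθ.zero, sub_zero, sub_zero] at h1
  rw [hπ] at h2
  have h3 : r * a ≤ r * x := mul_le_mul_of_nonneg_left hx.1 hr0
  have h4 : r * (1 - b) ≤ r * (1 - x) := mul_le_mul_of_nonneg_left (by linarith [hx.2]) hr0
  have hsin := sin_le_sin_of_mem (x := angle p m s lam x) hη hη' (by linarith) (by linarith)
  rw [deriv01, (hd x hx1).derivWithin (uniqueDiffOn_Icc zero_lt_one x hx1), abs_div,
    abs_of_pos hpx, ← mul_div_assoc]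
  refine div_le_div₀ (abs_nonneg _) (le_trans ?_ (lq x hx1)) hpx (h.p_le x)
  have := hsin.trans (le_abs_self _)
  calc _ = |w 0| * Real.exp (-κ) * s * Real.sin η := by ring
    _ ≤ _ := by gcongr

end IsExtension

end HoelderEigen

end

theorem mainTheorem10 (α : ℝ≥0) (hα : 0 < α) (hα1 : α ≤ 1) (d D : ℝ) (hd : 0 < d) (hdD : d < D) :
    (∃ c C : ℝ, 0 < c ∧ 0 < C ∧
      ∀ σ μ : ℝ → ℝ, HoelderEigen.MemTheta α d D σ μ →
        ∃ lam₁ lam₂ : ℝ,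
          HoelderEigen.IsNthEigenvalue σ μ 1 lam₁ ∧
          HoelderEigen.IsNthEigenvalue σ μ 2 lam₂ ∧
          c ≤ lam₁ ∧ lam₁ ≤ C ∧ lam₂ ≤ C ∧
          c ≤ lam₂ - lam₁ ∧
          ∀ w : ℝ → ℝ, HoelderEigen.IsEigenpair σ μ lam₁ w →
            DifferentiableOn ℝ w (Icc 0 1) ∧
            HoelderEigen.c1HolderNorm (min (1 / 2) α) w /
              ENNReal.ofReal (HoelderEigen.l2Norm μ w) ≤ ENNReal.ofReal C) ∧
    (∀ a b : ℝ, 0 < a → a < b → b < 1 →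
      ∃ c : ℝ, 0 < c ∧
        ∀ σ μ : ℝ → ℝ, HoelderEigen.MemTheta α d D σ μ →
          ∀ lam₁ : ℝ, HoelderEigen.IsNthEigenvalue σ μ 1 lam₁ →
            ∀ w : ℝ → ℝ, HoelderEigen.IsEigenpair σ μ lam₁ w →
              c * HoelderEigen.l2Norm μ w ≤
                ⨅ x : Icc a b, |HoelderEigen.deriv01 w x|) := by
  have hD : 0 < D := hd.trans hdD
  have hpi := Real.pi_pos
  set l := d ^ 3 with hl
  set L := 4 * D ^ 3 with hL
  have hl0 : 0 < l := by positivity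
  have hL0 : 0 < L := by positivity
  -- These constants involve only `d` and `D`; `α` enters only through the Hölder exponent.
  obtain ⟨s, hs⟩ : ∃ s, s = 2 * Real.pi * L := ⟨_, rfl⟩
  obtain ⟨Λ, hΛ⟩ : ∃ Λ, Λ = Real.pi * s / d := ⟨_, rfl⟩
  obtain ⟨κ, hκ⟩ : ∃ κ, κ = s / l + 2 * Λ * D / s := ⟨_, rfl⟩
  have hs0 : 0 < s := by rw [hs]; positivity
  have hΛ0 : 0 < Λ := by rw [hΛ]; positivity
  set g := Real.pi / (2 * D / s * Real.exp (2 * κ)) with hg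
  have hg0 : 0 < g := by positivity
  refine ⟨?_, fun a b ha hab hb => ?_⟩
  · set N := Real.exp κ + (Real.exp κ * s / l +
      (2 * Λ * D * Real.exp κ / l + Real.exp κ * s * (8 * D ^ 3) / l ^ 2)) with hN
    set B := Real.exp κ * s / l with hB
    have hB0 : 0 < B := by positivity
    set e := Real.sqrt (d / (4 * (1 + 2 * B))) with he
    have he0 : 0 < e := Real.sqrt_pos.2 (by positivity)
    have hN0 : 0 < N := by positivity
    refine ⟨g, max Λ (N / e), hg0, lt_max_of_lt_left hΛ0, fun σ μ hθ => ?_⟩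
    obtain ⟨p, m, h, hp⟩ := hθ.exists_isExtension hα hd hD.le
    obtain ⟨lam₁, lam₂, n1, n2, c1, b1, b2, c2, -⟩ := h.exists_eigenvalues hs hΛ hκ
    refine ⟨lam₁, lam₂, n1, n2, c1, b1.trans (le_max_left _ _), b2.trans (le_max_left _ _), c2,
      fun w hw => ?_⟩
    have hγ : min (1 / 2) α ≤ 1 := (min_le_right _ _).trans hα1
    obtain ⟨hdiff, hnorm⟩ := h.c1HolderNorm_le hγ hp hs0 hκ b1 hw
    refine ⟨hdiff, ENNReal.div_le_of_le_mul (hnorm.trans ?_)⟩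
    obtain ⟨q, -, -, -, lw, -, -⟩ := h.exists_flux hs0 hκ b1 hw
    have low := h.le_l2Norm hw.continuousOn hB0 lw
    rw [← ENNReal.ofReal_mul (hΛ0.le.trans (le_max_left _ _))]
    refine ENNReal.ofReal_le_ofReal ?_
    -- The Hölder norm is at most `|w 0| * N` and the `L²(μ)` norm at least `|w 0| * e`, so `|w 0|`
    -- cancels.
    calc |w 0| * N = N / e * (|w 0| * e) := by field_simp
      _ ≤ max Λ (N / e) * HoelderEigen.l2Norm μ w :=
          mul_le_mul (le_max_right _ _) low (by positivity) (hΛ0.le.trans (le_max_left _ _))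
  · set r := min (s / L) (2 * g * d / s) with hr
    have hr0 : 0 < r := lt_min (by positivity) (by positivity)
    set η := min (Real.pi / 2) (min (r * a) (r * (1 - b))) with hη
    have hη0 : 0 < η :=
      lt_min (by positivity) (lt_min (by positivity) (mul_pos hr0 (sub_pos.2 hb)))
    have hη1 : η ≤ Real.pi / 2 := min_le_left _ _
    have hsin : 0 < Real.sin η := Real.sin_pos_of_pos_of_lt_pi hη0 (by linarith)
    set M := Real.exp (-κ) * s * Real.sin η / L with hM
    have hM0 : 0 < M := by positivity
    refine ⟨M / (Real.exp κ * Real.sqrt D), by positivity, fun σ μ hθ lam hlam w hw => ?_⟩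
    obtain ⟨p, m, h, hp⟩ := hθ.exists_isExtension hα hd hD.le
    obtain ⟨lam₁, lam₂, n1, -, c1, b1, -, -, hπ⟩ := h.exists_eigenvalues hs hΛ hκ
    -- A least element is unique, so the given first eigenvalue is the constructed one with angle
    -- `π`.
    obtain rfl : lam = lam₁ := hlam.unique n1
    obtain ⟨q, -, bw, -, -, -, -⟩ := h.exists_flux hs0 hκ b1 hw
    have up := h.l2Norm_le (by positivity) bw
    have : Nonempty (Icc a b) := ⟨⟨a, le_rfl, hab.le⟩⟩
    refine le_ciInf fun x => le_trans ?_ (h.le_abs_deriv hs0 hκ b1 hg0.le c1 hπ hw hη0.le hη1 ha.le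
      hb.le ((min_le_right _ _).trans (min_le_left _ _))
      ((min_le_right _ _).trans (min_le_right _ _)) x.2)
    calc M / (Real.exp κ * Real.sqrt D) * HoelderEigen.l2Norm μ w
        ≤ M / (Real.exp κ * Real.sqrt D) * (|w 0| * Real.exp κ * Real.sqrt D) := by gcongr
      _ = |w 0| * M := by
          have := Real.sqrt_pos.2 hD
          field_simp
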